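/- **Proposition 1.1 (conservation laws).** Let $N\ge 1$, let $\lambda_1\in\mathbb{C}$ with $\operatorname{Im}\lambda_1>0$, and let $\mathbf c=(1,c_1,c_2)^{\mathrm T}$ with $(c_1,c_2)\in\mathbb{C}^2\setminus\{(0,0)\}$. Put $\sigma_3=\mathrm{diag}(1,-1,-1)$ and $\Phi^{[0]}(\lambda;x,t)=e^{-i\lambda(x+\lambda t)\sigma_3}$, and define recursively for $j\ge 1$ $$\phi^{[j-1]}(x,t)=\lim_{\lambda\to\lambda_1}\Phi^{[j-1]}(\lambda;x,t)\,\mathbf c,\qquad P^{[j]}=\frac{\phi^{[j-1]}(\phi^{[j-1]})^\dagger}{(\phi^{[j-1]})^\dagger\phi^{[j-1]}},\qquad T^{[j]}(\lambda;x,t)=\mathbb I-\frac{\lambda_1-\lambda_1^*}{\lambda-\lambda_1^*}P^{[j]}(x,t),$$ $$\Phi^{[j]}(\lambda;x,t)=T^{[j]}(\lambda;x,t)\,\Phi^{[j-1]}(\lambda;x,t)\,\bigl(T^{[j]}(\lambda;0,0)\bigr)^{-1},$$ where the limit is over $\lambda\ne\lambda_1$. These limits exist and are nonzero for all real $x,t$.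 Let $q_1,q_2$ be the $(1,2)$ and $(1,3)$ entries of $\mathcal Q^{[N]}=(\lambda_1-\lambda_1^*)\sum_{j=1}^N[\sigma_3,P^{[j]}]$ (the $N$-th order soliton of the coupled nonlinear Schrödinger equation $i\mathbf q_t+\tfrac12\mathbf q_{xx}+\mathbf q\mathbf q^\dagger\mathbf q=0$, $\mathbf q=(q_1,q_2)$). Then for every $t\in\mathbb{R}$ the functions $q_1,q_2$ are $C^\infty$ in $x$, all the integrals below converge absolutely, and $$I_1=\int_{-\infty}^{\infty}\left(|q_1|^2+|q_2|^2\right)dx=4N\operatorname{Im}\lambda_1,$$ $$I_2=-\frac i2\int_{-\infty}^{\infty}\left(q_1q_{1,x}^*+q_2q_{2,x}^*-q_1^*q_{1,x}-q_2^*q_{2,x}\right)dx=8N\operatorname{Re}\lambda_1\operatorname{Im}\lambda_1,$$ $$I_3=\int_{-\infty}^{\infty}\left[|q_{1,x}|^2+|q_{2,x}|^2-\left(|q_1|^2+|q_2|^2\right)^2\right]dx=\frac{16}{3}N\operatorname{Im}\lambda_1\left(3(\operatorname{Re}\lambda_1)^2-(\operatorname{Im}\lambda_1)^2\right).$$ More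 generally, define for $l=1,2$ $$\mu^{(l)}_1=-i\,q_l^*,\qquad \mu^{(l)}_{n+1}=-\partial_x\mu^{(l)}_n+i\sum_{k=1}^{n-1}\mu^{(l)}_k\left(q_1\mu^{(1)}_{n-k}+q_2\mu^{(2)}_{n-k}\right)\qquad(n\ge1).$$ Then for every $n\ge 1$ and every $t\in\mathbb{R}$ $$\mathcal I_n=\int_{-\infty}^{\infty}\left(i q_1\mu^{(1)}_n+i q_2\mu^{(2)}_n\right)dx=\frac{N(-2i)^n\left(\lambda_1^n-(\lambda_1^*)^n\right)}{n}.$$ (In these normalizations $I_1=\mathcal I_1$, $I_2=i\,\mathcal I_2$ and $I_3=-\mathcal I_3$.) -/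

import Mathlib

open Filter Topology MeasureTheory
open scoped ContDiff

noncomputable section

namespace CNLS

/-- The matrix `σ₃ = diag(1, -1, -1)`. -/
def sigma3 : Matrix (Fin 3) (Fin 3) ℂ := Matrix.diagonal ![1, -1, -1]

/-- The phase `z (x + z t)`. -/
def phase (z : ℂ) (x t : ℝ) : ℂ := z * ((x : ℂ) + z * (t : ℂ))

/-- The fundamental solution `exp(-i z (x + z t) σ₃)` of the Lax pair with zero potential. -/
def vacuumWave (z : ℂ) (x t : ℝ) : Matrix (Fin 3) (Fin 3) ℂ :=
  Matrix.diagonal ![Complex.exp (-Complex.I * phase z x t),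
    Complex.exp (Complex.I * phase z x t), Complex.exp (Complex.I * phase z x t)]

/-- The constant vector `c = (1, c₁, c₂)ᵀ`. -/
def dressingVec (c₁ c₂ : ℂ) : Fin 3 → ℂ := ![1, c₁, c₂]

/-- The orthogonal projection `v v† / (v† v)` onto the line spanned by `v`. -/
def lineProj (v : Fin 3 → ℂ) : Matrix (Fin 3) (Fin 3) ℂ :=
  (star v ⬝ᵥ v)⁻¹ • Matrix.vecMulVec v (star v)

/-- The elementary Darboux matrix `𝕀 - (λ₁ - λ₁*) / (z - λ₁*) P`. -/
def darbouxFactor (lam : ℂ) (P : Matrix (Fin 3) (Fin 3) ℂ) (z : ℂ) :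
    Matrix (Fin 3) (Fin 3) ℂ :=
  1 - ((lam - star lam) / (z - star lam)) • P

/-- For a wave function `Ψ`, the projection `P(x,t)` onto the line spanned by the limit as
`z → λ₁` of `Ψ(z; x, t) v`. The wave functions to which this is applied have a removable
singularity at `λ₁`, hence the punctured neighbourhood. -/
def waveProj (lam : ℂ) (v : Fin 3 → ℂ) (Ψ : ℂ → ℝ → ℝ → Matrix (Fin 3) (Fin 3) ℂ)
    (x t : ℝ) : Matrix (Fin 3) (Fin 3) ℂ :=
  lineProj (limUnder (𝓝[≠] lam) fun z => (Ψ z x t).mulVec v)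

/-- The wave functions of the iterated Darboux transformation at the single spectral point `λ₁`:
`Φ⁽⁰⁾ = exp(-i z (x + z t) σ₃)` and
`Φ⁽ʲ⁺¹⁾(z; x, t) = T⁽ʲ⁺¹⁾(z; x, t) Φ⁽ʲ⁾(z; x, t) T⁽ʲ⁺¹⁾(z; 0, 0)⁻¹`. -/
def waveFun (lam c₁ c₂ : ℂ) : ℕ → ℂ → ℝ → ℝ → Matrix (Fin 3) (Fin 3) ℂ
  | 0 => vacuumWave
  | j + 1 => fun z x t =>
      darbouxFactor lam (waveProj lam (dressingVec c₁ c₂) (waveFun lam c₁ c₂ j) x t) z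
        * waveFun lam c₁ c₂ j z x t
        * (darbouxFactor lam (waveProj lam (dressingVec c₁ c₂) (waveFun lam c₁ c₂ j) 0 0) z)⁻¹

/-- The potential of the `N`-th order soliton, `(λ₁ - λ₁*) ∑ [σ₃, P⁽ⁱ⁾(x, t)]`, the sum running
over the projections of the `N` Darboux steps. -/
def solitonPotential (lam c₁ c₂ : ℂ) (N : ℕ) (x t : ℝ) : Matrix (Fin 3) (Fin 3) ℂ :=
  (lam - star lam) • ∑ j ∈ Finset.range N,
    (sigma3 * waveProj lam (dressingVec c₁ c₂) (waveFun lam c₁ c₂ j) x t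
      - waveProj lam (dressingVec c₁ c₂) (waveFun lam c₁ c₂ j) x t * sigma3)

/-- The component `q₁` (for `l = 0`) or `q₂` (for `l = 1`) of the `N`-th order soliton, at time
`t`, as a function of `x`: the entries `(1, 2)` and `(1, 3)` of the potential. -/
def soliton (lam c₁ c₂ : ℂ) (N : ℕ) (t : ℝ) (l : Fin 2) (x : ℝ) : ℂ :=
  solitonPotential lam c₁ c₂ N x t 0 l.succ

/-- The coefficients `μ_n⁽ˡ⁾` of the expansion `μ⁽ˡ⁾ = -∑_{n ≥ 1} μ_n⁽ˡ⁾ / (-2 i λ)ⁿ` of the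
solution of the Riccati equations, for the potential `q = (q₁, q₂)`:
`μ_1⁽ˡ⁾ = -i q_l*` and
`μ_{n+1}⁽ˡ⁾ = -∂ₓ μ_n⁽ˡ⁾ + i ∑_{k=1}^{n-1} μ_k⁽ˡ⁾ (q₁ μ_{n-k}⁽¹⁾ + q₂ μ_{n-k}⁽²⁾)`.
The value at `n = 0` is a placeholder. In the last clause the index `n` of the recurrence is
`n + 1` and `k` is `k + 1`. -/
def riccatiCoeff (q : Fin 2 → ℝ → ℂ) : ℕ → Fin 2 → ℝ → ℂ
  | 0 => fun _ _ => 0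
  | 1 => fun l x => -Complex.I * star (q l x)
  | n + 2 => fun l x =>
      -deriv (riccatiCoeff q (n + 1) l) x
        + Complex.I * ∑ k : Fin n, riccatiCoeff q (k.1 + 1) l x
            * ∑ m : Fin 2, q m x * riccatiCoeff q (n - k.1) m x
  termination_by n => n
  decreasing_by all_goals omega

/-- The `n`-th conserved density `i q₁ μ_n⁽¹⁾ + i q₂ μ_n⁽²⁾`. -/
def conservedDensity (q : Fin 2 → ℝ → ℂ) (n : ℕ) (x : ℝ) : ℂ :=
  ∑ l : Fin 2, Complex.I * q l x * riccatiCoeff q n l x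

end CNLS

end

/-! The problem is first reduced to a scalar one. With `κ` the length of `(c₁, c₂)` and `e = (c₁,
c₂) / κ`, every dressed wave applied to the dressing vector stays in the plane of `e₁` and `(0, e)`.
Hence `q_l = u * star (e l)` for a single potential `u` (`solitonPotential_apply`), and all the
densities depend on `u` alone.

All Darboux steps use the same point `lam`. Write `ν = lam - star lam`. The normalization at the
origin multiplies the dressing vector by `(z - star lam) / (z - lam)`, so one step acts as `1 + ν /
(z - lam) * (1 - P)`. Since `1 - P` kills the value at `lam`, the singularity is removable. On
Taylor coefficients at `lam` the step reads `w_k ↦ w_k + ν (1 - P) w_{k+1}`, which is `dress`. These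
coefficients solve the spatial Lax equation order by order (`IsWave.dress`). They are exponentials
times polynomials for the vacuum, and domination of one component survives each step
(`FstDominant.dress`). So every `P` tends exponentially fast to `diag(1, 0)` at `+∞` and to `diag(0,
1)` at `-∞`.

The integrals come from the expansion at `λ = ∞`. With `X = 1 / λ`, the first column `(F, G)` of the
product of Darboux factors is a formal Lax solution with the vacuum exponential removed, and `F' =
-i u G`. The ratio `ξ = G / F` solves the Riccati equation, whose coefficients are the `μ_n` up to
the factors `e l` and `(-2i)^n`. Moreover `(log F)' = -i u ξ`; applying `X d/dX` turns the left side
into `X F_X / F`, so no formal logarithm is needed. Between `-∞` and `+∞`, `F` goes from `1` to `((1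
- lam X) / (1 - star lam X))^N`. The logarithmic derivative of this limit is `N (geom (star lam) -
geom lam)`, and comparing coefficients gives every integral of `u ξ_n`. Mass, momentum and energy
are the cases `n = 1, 2, 3`, up to conjugation and integration by parts. -/

noncomputable section

namespace CNLS

/-! ### Taylor coefficients of the dressed waves -/

/-- A pair of sequences: the Taylor coefficients of the two components of a wave. -/
abbrev CoeffPair := (ℕ → ℂ) × (ℕ → ℂ)

/-- The squared length of the leading coefficient. -/
def gram (w : CoeffPair) : ℂ := w.1 0 * star (w.1 0) + w.2 0 * star (w.2 0)

/-- The first diagonal entry of the projection onto the leading coefficient. -/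
def projDiag (w : CoeffPair) : ℂ := w.1 0 * star (w.1 0) / gram w

/-- The off-diagonal entry of the projection onto the leading coefficient. -/
def projOff (w : CoeffPair) : ℂ := w.1 0 * star (w.2 0) / gram w

/-- The first component of a wave after one Darboux step. -/
def dressFst (ν : ℂ) (w : CoeffPair) (k : ℕ) : ℂ :=
  w.1 k + ν * (projDiag w.swap * w.1 (k + 1) - projOff w * w.2 (k + 1))

/-- One Darboux step, on Taylor coefficients. -/
def dress (ν : ℂ) (w : CoeffPair) : CoeffPair := (dressFst ν w, dressFst ν w.swap)

/-- Exchanging the components is a symmetry of the construction. It yields the second component from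
the first, and the end `-∞` from `+∞`. -/
lemma dress_swap (ν : ℂ) (w : CoeffPair) : dress ν w.swap = (dress ν w).swap := rfl

lemma iterate_dress_swap (ν : ℂ) (j : ℕ) (w : CoeffPair) :
    (dress ν)^[j] w.swap = ((dress ν)^[j] w).swap :=
  ((Function.Semiconj.iterate_right (f := Prod.swap) (fun w => (dress_swap ν w).symm) j) w).symm

lemma gram_swap (w : CoeffPair) : gram w.swap = gram w := add_comm _ _

lemma gram_eq (w : CoeffPair) : gram w = ((‖w.1 0‖ ^ 2 + ‖w.2 0‖ ^ 2 : ℝ) : ℂ) := by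
  simp [gram, Complex.mul_conj, Complex.normSq_eq_norm_sq]

lemma star_gram (w : CoeffPair) : star (gram w) = gram w := by
  rw [gram_eq]; exact Complex.conj_ofReal _

lemma gram_eq_zero_iff (w : CoeffPair) : gram w = 0 ↔ w.1 0 = 0 ∧ w.2 0 = 0 := by
  rw [gram_eq, Complex.ofReal_eq_zero, add_eq_zero_iff_of_nonneg (by positivity) (by positivity)]
  simp

lemma projDiag_swap {w : CoeffPair} (h : gram w ≠ 0) : projDiag w.swap = 1 - projDiag w := by
  rw [projDiag, projDiag, gram_swap, eq_sub_iff_add_eq, ← add_div, div_eq_one_iff_eq h, gram,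
    add_comm]
  rfl

lemma star_projDiag (w : CoeffPair) : star (projDiag w) = projDiag w := by
  simp only [projDiag, star_div₀, star_gram, star_mul', star_star, mul_comm]

lemma projOff_swap (w : CoeffPair) : projOff w.swap = star (projOff w) := by
  simp only [projOff, star_div₀, star_gram, star_mul', star_star, gram_swap, Prod.fst_swap,
    Prod.snd_swap, mul_comm]

lemma projOff_mul_star {w : CoeffPair} (h : gram w ≠ 0) :
    projOff w * star (projOff w) = projDiag w * (1 - projDiag w) := by
  rw [← projDiag_swap h, ← projOff_swap]
  simp only [projDiag, projOff, gram_swap, Prod.fst_swap, Prod.snd_swap]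
  ring

/-- This is `(1 - P) w_0 = 0`, which cancels the pole of a Darboux step at `lam`. -/
lemma proj_annihilates (w : CoeffPair) : projDiag w.swap * w.1 0 - projOff w * w.2 0 = 0 := by
  simp only [projDiag, projOff, gram_swap, Prod.fst_swap]
  ring

/-- The new leading coefficient is `w_0 + ν (1 - P) w_1`. The second term is orthogonal to `w_0`, so
pairing with `w_0` returns `gram w`. -/
lemma gram_dress_ne_zero (ν : ℂ) {w : CoeffPair} (h : gram w ≠ 0) : gram (dress ν w) ≠ 0 := by
  intro h0
  obtain ⟨h1, h2⟩ := (gram_eq_zero_iff _).1 h0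
  apply h
  have e : star (w.1 0) * (dress ν w).1 0 + star (w.2 0) * (dress ν w).2 0 = gram w := by
    simp only [dress, dressFst, projDiag, projOff, gram_swap, Prod.fst_swap, Prod.snd_swap,
      Prod.swap_swap]
    simp only [gram]
    ring
  rw [← e, h1, h2]; simp

lemma gram_iterate_ne_zero (ν : ℂ) {w : CoeffPair} (h : gram w ≠ 0) (j : ℕ) :
    gram ((dress ν)^[j] w) ≠ 0 := by
  induction j with
  | zero => exact h
  | succ j ih => rw [Function.iterate_succ_apply']; exact gram_dress_ne_zero ν ih

/-! ### Exponential growth classes -/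

/-- `u` grows at most like `exp (b x)` for every `b > a`. -/
def ExpType (a : ℝ) (u : ℝ → ℂ) : Prop :=
  ∀ b, a < b → u =O[atTop] fun x : ℝ => Real.exp (b * x)

namespace ExpType

variable {a b : ℝ} {u v : ℝ → ℂ}

lemma add (hu : ExpType a u) (hv : ExpType a v) : ExpType a (fun x => u x + v x) :=
  fun c hc => (hu c hc).add (hv c hc)

lemma sub (hu : ExpType a u) (hv : ExpType a v) : ExpType a (fun x => u x - v x) :=
  fun c hc => (hu c hc).sub (hv c hc)

lemma congr (hu : ExpType a u) (h : ∀ x, u x = v x) : ExpType a v := (funext h : u = v) ▸ hu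

lemma mono (hu : ExpType a u) (h : a ≤ b) : ExpType b u := fun c hc => hu c (h.trans_lt hc)

lemma mul (hu : ExpType a u) (hv : ExpType b v) : ExpType (a + b) (fun x => u x * v x) := by
  intro c hc
  refine ((hu (a + (c - (a + b)) / 2) (by linarith)).mul
    (hv (b + (c - (a + b)) / 2) (by linarith))).congr_right fun x => ?_
  rw [← Real.exp_add]; ring_nf

lemma of_isBigO (h : u =O[atTop] fun x : ℝ => Real.exp (a * x)) : ExpType a u := by
  intro c hc
  refine h.trans (Asymptotics.IsBigO.of_bound 1 ?_)
  filter_upwards [eventually_ge_atTop 0] with x hx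
  rw [one_mul, Real.norm_of_nonneg (Real.exp_nonneg _), Real.norm_of_nonneg (Real.exp_nonneg _)]
  gcongr

lemma const (c : ℂ) : ExpType 0 (fun _ => c) := by
  apply of_isBigO
  simpa using Asymptotics.isBigO_const_const c (one_ne_zero (α := ℝ)) atTop

protected lemma star (hu : ExpType a u) : ExpType a (fun x => star (u x)) := fun b hb =>
  Asymptotics.IsBigO.of_norm_left (by simpa only [norm_star] using (hu b hb).norm_left)

lemma const_mul (c : ℂ) (hu : ExpType a u) : ExpType a (fun x => c * u x) :=
  fun b hb => (hu b hb).const_mul_left c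

/-- Polynomial factors leave the exponential type unchanged, which is the purpose of the strict
inequality in `ExpType`. -/
lemma pow_const_mul (c : ℂ) (i : ℕ) : ExpType 0 (fun x : ℝ => (c * (x : ℂ)) ^ i) := by
  intro b hb
  have h := (isLittleO_pow_exp_pos_mul_atTop i hb).isBigO
  refine ((Asymptotics.isBigO_of_le' (c := ‖c‖ ^ i) _ fun x => ?_).trans h)
  simp [mul_pow]

lemma sum {ι : Type*} (s : Finset ι) {u : ι → ℝ → ℂ} (h : ∀ i ∈ s, ExpType a (u i)) :
    ExpType a (fun x => ∑ i ∈ s, u i x) :=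
  fun b hb => Asymptotics.IsBigO.fun_sum fun i hi => h i hi b hb

lemma exp_mul (c : ℂ) : ExpType c.re (fun x : ℝ => Complex.exp (c * x)) := by
  apply of_isBigO
  apply Asymptotics.isBigO_of_le
  intro x
  simp [Complex.norm_exp]

lemma isLittleO (hu : ExpType a u) (h : a < b) : u =o[atTop] fun x : ℝ => Real.exp (b * x) := by
  refine (hu ((a + b) / 2) (by linarith)).trans_isLittleO ?_
  rw [Real.isLittleO_exp_comp_exp_comp]
  have : Tendsto (fun x : ℝ => (b - (a + b) / 2) * x) atTop atTop :=
    tendsto_id.const_mul_atTop (by linarith)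
  refine this.congr fun x => ?_
  ring

end ExpType

/-! ### Asymptotics of the dressed waves -/

/-- The first component dominates at `+∞`. -/
structure FstDominant (η : ℝ) (w : ℝ → CoeffPair) : Prop where
  fst_type : ∀ k, ExpType η (fun x => (w x).1 k)
  snd_type : ∀ k, ExpType (-η) (fun x => (w x).2 k)
  lower : (fun x : ℝ => Real.exp (η * x)) =O[atTop] (fun x => (w x).1 0)

lemma norm_gram_ge (w : CoeffPair) : ‖w.1 0‖ ^ 2 ≤ ‖gram w‖ := by
  rw [gram_eq, Complex.norm_real, Real.norm_of_nonneg (by positivity)]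
  nlinarith [sq_nonneg ‖w.2 0‖]

namespace FstDominant

variable {η : ℝ} {w : ℝ → CoeffPair}

lemma inv_gram (h : FstDominant η w) :
    ExpType (-η - η) (fun x => (gram (w x))⁻¹) := by
  apply ExpType.of_isBigO
  have h2 : (fun x : ℝ => Real.exp (-(-η - η) * x)) =O[atTop] fun x => gram (w x) := by
    refine ((h.lower.mul h.lower).congr_left (fun x => ?_)).trans
      (Asymptotics.isBigO_of_le _ fun x => ?_)
    · rw [← Real.exp_add]; ring_nf
    · rw [norm_mul, ← sq]; exact norm_gram_ge _
  refine (h2.inv_rev ?_).congr_right fun x => ?_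
  · exact Eventually.of_forall fun x hx => absurd hx (Real.exp_ne_zero _)
  · rw [← Real.exp_neg]; ring_nf

lemma expType_projOff (h : FstDominant η w) :
    ExpType (-(2 * η)) (fun x => projOff (w x)) :=
  (((h.fst_type 0).mul (h.snd_type 0).star).mul h.inv_gram).mono (by linarith)

lemma expType_projDiag_swap (h : FstDominant η w) :
    ExpType (-(4 * η)) (fun x => projDiag (w x).swap) := by
  simp only [projDiag, gram_swap, div_eq_mul_inv]
  exact (((h.snd_type 0).mul (h.snd_type 0).star).mul h.inv_gram).mono (by linarith)

/-- The correction to the first component has type `-3η`: it combines `1 - p` of type `-4η` with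
type `η`, and `r` of type `-2η` with type `-η`. In the second component the correction has type
`-η`, which is just what is allowed. -/
lemma dress (hη : 0 < η) (ν : ℂ) (h : FstDominant η w) (hw : ∀ x, gram (w x) ≠ 0) :
    FstDominant η (fun x => dress ν (w x)) := by
  have hd : ∀ k, ExpType (-(3 * η)) (fun x => ν * (projDiag (w x).swap * (w x).1 (k + 1)
      - projOff (w x) * (w x).2 (k + 1))) := fun k =>
    (((h.expType_projDiag_swap.mul (h.fst_type (k + 1))).mono (by linarith)).sub
      ((h.expType_projOff.mul (h.snd_type (k + 1))).mono (by linarith))).const_mul ν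
  refine ⟨fun k => (h.fst_type k).add ((hd k).mono (by linarith)), fun k => ?_, ?_⟩
  · have h1 : ExpType 0 (fun x => projDiag (w x)) := by
      have := (ExpType.const 1).sub (h.expType_projDiag_swap.mono (by linarith : _ ≤ (0 : ℝ)))
      refine fun b hb => (this b hb).congr_left fun x => ?_
      rw [projDiag_swap (hw x)]; ring
    have h2 : ExpType (-(2 * η)) (fun x => projOff (w x).swap) := by
      simp only [projOff_swap]
      exact h.expType_projOff.star
    exact (h.snd_type k).add ((((h1.mul (h.snd_type (k + 1))).mono (by linarith)).sub
      ((h2.mul (h.fst_type (k + 1))).mono (by linarith))).const_mul ν)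
  -- The correction is negligible against the leading coefficient, so the lower bound persists.
  · have h1 := ((hd 0).isLittleO (by linarith : -(3 * η) < η)).trans_isBigO h.lower
    refine h.lower.trans (h1.right_isBigO_add.congr_right fun x => ?_)
    simp only [CNLS.dress, dressFst]
    ring

lemma iterate_dress (hη : 0 < η) (ν : ℂ) (h : FstDominant η w) (hw : ∀ x, gram (w x) ≠ 0) (j : ℕ) :
    FstDominant η (fun x => (CNLS.dress ν)^[j] (w x)) := by
  induction j with
  | zero => exact h
  | succ j ih =>
    simp only [Function.iterate_succ_apply']
    exact ih.dress hη ν fun x => gram_iterate_ne_zero ν (hw x) j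

lemma isBigO_projOff (hη : 0 < η) (h : FstDominant η w) :
    (fun x => projOff (w x)) =O[atTop] fun x : ℝ => Real.exp (-η * x) :=
  h.expType_projOff _ (by linarith)

lemma isBigO_projDiag_swap (hη : 0 < η) (h : FstDominant η w) :
    (fun x => projDiag (w x).swap) =O[atTop] fun x : ℝ => Real.exp (-η * x) :=
  h.expType_projDiag_swap _ (by linarith)

end FstDominant

/-! ### The spatial part of the Lax pair, on Taylor coefficients -/

/-- The sequence shifted by one, starting with `0`. -/
def prev (a : ℕ → ℂ) : ℕ → ℂ
  | 0 => 0
  | k + 1 => a k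

lemma prev_succ (a : ℕ → ℂ) (k : ℕ) : prev a (k + 1) = a k := rfl

/-- The pair `w` solves the spatial part of the Lax pair with potential `u`, to all orders at the
spectral point `lam`; here `s` is `-i`, or `i` with the two components exchanged. -/
structure IsWave (s lam : ℂ) (u : ℝ → ℂ) (w : ℝ → CoeffPair) : Prop where
  fst : ∀ k x, HasDerivAt (fun y => (w y).1 k)
    (s * (lam * (w x).1 k + u x * (w x).2 k + prev (w x).1 k)) x
  snd : ∀ k x, HasDerivAt (fun y => (w y).2 k)
    (-s * (lam * (w x).2 k - star (u x) * (w x).1 k + prev (w x).2 k)) x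

namespace IsWave

variable {s lam : ℂ} {u : ℝ → ℂ} {w : ℝ → CoeffPair}

/-- Exchanging the components changes the sign of `σ₃`, hence of `s`, and replaces `u` by `-star u`.
-/
lemma swap (h : IsWave s lam u w) :
    IsWave (-s) lam (fun x => -star (u x)) (fun x => (w x).swap) where
  fst k x := (h.snd k x).congr_deriv (by simp only [Prod.fst_swap, Prod.snd_swap]; ring)
  snd k x := (h.fst k x).congr_deriv (by
    simp only [Prod.fst_swap, Prod.snd_swap, star_neg, star_star]; ring)

lemma hasDerivAt_gram (h : IsWave s lam u w) (hs : star s = -s) (x : ℝ) :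
    HasDerivAt (fun y => gram (w y)) (s * (lam - star lam) *
      ((w x).1 0 * star ((w x).1 0) - (w x).2 0 * star ((w x).2 0))) x := by
  have hf := h.fst 0 x
  have hg := h.snd 0 x
  refine ((hf.fun_mul hf.star).fun_add (hg.fun_mul hg.star)).congr_deriv ?_
  simp only [prev, star_mul', star_add, star_sub, star_neg, hs, star_star, star_zero]
  ring

lemma hasDerivAt_projDiag (h : IsWave s lam u w) (hs : star s = -s) (hw : ∀ x, gram (w x) ≠ 0)
    (x : ℝ) :
    HasDerivAt (fun y => projDiag (w y)) (s * (2 * (lam - star lam) * projDiag (w x)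
      * (1 - projDiag (w x)) + u x * star (projOff (w x)) - star (u x) * projOff (w x))) x := by
  have hf := h.fst 0 x
  refine ((hf.fun_mul hf.star).fun_div (h.hasDerivAt_gram hs x) (hw x)).congr_deriv ?_
  have hΔ := hw x
  simp only [prev, star_mul', star_add, hs, star_star, star_zero, projDiag, projOff,
    star_div₀, star_gram]
  field_simp
  simp only [gram]
  ring

/-- The projection depends only on the order-zero coefficients, whose linear equation is closed, so
it satisfies a Riccati-type equation. The hypothesis `star s = -s` gives the conjugate equation. -/
lemma hasDerivAt_projOff (h : IsWave s lam u w) (hs : star s = -s) (hw : ∀ x, gram (w x) ≠ 0)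
    (x : ℝ) :
    HasDerivAt (fun y => projOff (w y)) (s * ((lam + star lam) * projOff (w x)
      + u x * (1 - 2 * projDiag (w x))
      - (lam - star lam) * projOff (w x) * (2 * projDiag (w x) - 1))) x := by
  have hf := h.fst 0 x
  have hg := h.snd 0 x
  refine ((hf.fun_mul hg.star).fun_div (h.hasDerivAt_gram hs x) (hw x)).congr_deriv ?_
  have hΔ := hw x
  simp only [prev, star_mul', star_add, star_sub, star_neg, hs, star_star, star_zero, projDiag,
    projOff]
  field_simp
  simp only [gram]
  ring

/-- At `k = 0` the bracket vanishes because `1 - P` kills the leading coefficient. This makes the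
lowest-order Lax equation fit the general pattern. -/
lemma prev_dressFst (ν : ℂ) (w : CoeffPair) (k : ℕ) :
    prev (dressFst ν w) k
      = prev w.1 k + ν * (projDiag w.swap * w.1 k - projOff w * w.2 k) := by
  cases k with
  | zero => simp [prev, proj_annihilates]
  | succ k => rfl

lemma dress_fst (h : IsWave s lam u w) (hs : star s = -s) (hw : ∀ x, gram (w x) ≠ 0) (k : ℕ)
    (x : ℝ) : HasDerivAt (fun y => (dress (lam - star lam) (w y)).1 k)
      (s * (lam * (dress (lam - star lam) (w x)).1 k
        + (u x + 2 * (lam - star lam) * projOff (w x)) * (dress (lam - star lam) (w x)).2 k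
        + prev (dress (lam - star lam) (w x)).1 k)) x := by
  have hp := h.hasDerivAt_projDiag hs hw x
  have hr := h.hasDerivAt_projOff hs hw x
  have key := (h.fst k x).fun_add ((((hp.const_sub 1).fun_mul (h.fst (k + 1) x)).fun_sub
    (hr.fun_mul (h.snd (k + 1) x))).const_mul (lam - star lam))
  refine (key.congr_deriv ?_).congr_of_eventuallyEq (Eventually.of_forall fun y => ?_)
  · simp only [dress, prev_dressFst, dressFst, projDiag_swap (hw x), projOff_swap, prev_succ,
      Prod.fst_swap, Prod.snd_swap, Prod.swap_swap]
    -- The only nonlinear relation needed is `|r|² = p (1 - p)`, that is, `P² = P`.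
    have e := projOff_mul_star (hw x)
    generalize projOff (w x) = r at e ⊢
    generalize star r = rb at e ⊢
    generalize projDiag (w x) = p at e ⊢
    generalize star (u x) = ub at e ⊢
    linear_combination (2 * s * (lam - star lam) ^ 2 * (w x).1 (k + 1)) * e
  · simp only [dress, dressFst, projDiag_swap (hw y)]

lemma dress (h : IsWave s lam u w) (hs : star s = -s) (hw : ∀ x, gram (w x) ≠ 0) :
    IsWave s lam (fun x => u x + 2 * (lam - star lam) * projOff (w x))
      (fun x => dress (lam - star lam) (w x)) where
  fst := h.dress_fst hs hw
  snd k x := by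
    have := h.swap.dress_fst (by rw [star_neg, hs]) (fun x => by rw [gram_swap]; exact hw x) k x
    refine this.congr_deriv ?_
    simp only [dress_swap, Prod.fst_swap, Prod.snd_swap, projOff_swap, star_add, star_mul',
      star_sub, star_star, star_ofNat]
    ring

end IsWave

/-- The potential after `j` Darboux steps from the zero potential. -/
def scalarPot (ν : ℂ) (w : CoeffPair) (j : ℕ) : ℂ :=
  2 * ν * ∑ i ∈ Finset.range j, projOff ((dress ν)^[i] w)

lemma IsWave.iterate_dress {s lam : ℂ} {w : ℝ → CoeffPair} (h : IsWave s lam (fun _ => 0) w)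
    (hs : star s = -s) (hw : ∀ x, gram (w x) ≠ 0) (j : ℕ) :
    IsWave s lam (fun x => scalarPot (lam - star lam) (w x) j)
      (fun x => (CNLS.dress (lam - star lam))^[j] (w x)) := by
  induction j with
  | zero => simpa [scalarPot] using h
  | succ j ih =>
    simp only [Function.iterate_succ_apply', scalarPot, Finset.sum_range_succ, mul_add]
    exact ih.dress hs fun x => gram_iterate_ne_zero _ (hw x) j

/-! ### Smoothness -/

lemma contDiff_star {u : ℝ → ℂ} (h : ContDiff ℝ ∞ u) : ContDiff ℝ ∞ (fun x => star (u x)) :=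
  Complex.conjCLE.contDiff.comp h

/-- All coefficients of `w` depend smoothly on `x`. -/
def SmoothPair (w : ℝ → CoeffPair) : Prop :=
  ∀ k, ContDiff ℝ ∞ (fun x => (w x).1 k) ∧ ContDiff ℝ ∞ (fun x => (w x).2 k)

namespace SmoothPair

variable {w : ℝ → CoeffPair}

lemma gram (h : SmoothPair w) : ContDiff ℝ ∞ (fun x => CNLS.gram (w x)) :=
  ((h 0).1.mul (contDiff_star (h 0).1)).add ((h 0).2.mul (contDiff_star (h 0).2))

lemma projDiag (h : SmoothPair w) (hw : ∀ x, CNLS.gram (w x) ≠ 0) :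
    ContDiff ℝ ∞ (fun x => CNLS.projDiag (w x)) :=
  ((h 0).1.mul (contDiff_star (h 0).1)).mul ((h.gram).inv hw)

lemma projOff (h : SmoothPair w) (hw : ∀ x, CNLS.gram (w x) ≠ 0) :
    ContDiff ℝ ∞ (fun x => CNLS.projOff (w x)) :=
  ((h 0).1.mul (contDiff_star (h 0).2)).mul ((h.gram).inv hw)

lemma swap (h : SmoothPair w) : SmoothPair (fun x => (w x).swap) := fun k => (h k).symm

lemma dress (ν : ℂ) (h : SmoothPair w) (hw : ∀ x, CNLS.gram (w x) ≠ 0) :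
    SmoothPair (fun x => CNLS.dress ν (w x)) := by
  have hfst : ∀ {w : ℝ → CoeffPair}, SmoothPair w → (∀ x, CNLS.gram (w x) ≠ 0) → ∀ k,
      ContDiff ℝ ∞ (fun x => dressFst ν (w x) k) := fun {w} h hw k =>
    (h k).1.add (contDiff_const.mul ((((h.swap.projDiag fun x => by
      rw [gram_swap]; exact hw x)).mul (h (k + 1)).1).sub ((h.projOff hw).mul (h (k + 1)).2)))
  exact fun k => ⟨hfst h hw k, hfst h.swap (fun x => by rw [gram_swap]; exact hw x) k⟩

lemma iterate_dress (ν : ℂ) (h : SmoothPair w) (hw : ∀ x, CNLS.gram (w x) ≠ 0) (j : ℕ) :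
    SmoothPair (fun x => (CNLS.dress ν)^[j] (w x)) := by
  induction j with
  | zero => exact h
  | succ j ih =>
    simp only [Function.iterate_succ_apply']
    exact ih.dress ν fun x => gram_iterate_ne_zero ν (hw x) j

lemma scalarPot (ν : ℂ) (h : SmoothPair w) (hw : ∀ x, CNLS.gram (w x) ≠ 0) (j : ℕ) :
    ContDiff ℝ ∞ (fun x => CNLS.scalarPot ν (w x) j) :=
  contDiff_const.mul (ContDiff.sum fun i _ =>
    (h.iterate_dress ν hw i).projOff fun x => gram_iterate_ne_zero ν (hw x) i)

end SmoothPair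

/-! ### The vacuum wave -/

/-- The Taylor coefficients at `lam` of `z ↦ exp (s z (x + z t))`. -/
def expCoeff (s lam : ℂ) (t x : ℝ) (k : ℕ) : ℂ :=
  Complex.exp (s * lam * x) * ∑ p ∈ Finset.HasAntidiagonal.antidiagonal k,
    (s * (x : ℂ)) ^ p.1 / (p.1.factorial : ℂ)
      * ((p.2.factorial : ℂ)⁻¹ * iteratedDeriv p.2 (fun z => Complex.exp (s * z ^ 2 * t)) lam)

/-- Cauchy product of the expansions of `exp (s x (z - lam))` and `exp (s z² t)`. Splitting off `exp
(s lam x)` shows each coefficient as an exponential times a polynomial in `x`. -/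
lemma hasSum_expCoeff (s lam : ℂ) (t x : ℝ) (z : ℂ) :
    HasSum (fun k => (z - lam) ^ k * expCoeff s lam t x k)
      (Complex.exp (s * phase z x t)) := by
  have h1 : HasSum (fun n : ℕ => (z - lam) ^ n * ((s * (x : ℂ)) ^ n / (n.factorial : ℂ)))
      (Complex.exp (s * x * (z - lam))) := by
    rw [Complex.exp_eq_exp_ℂ]
    refine (NormedSpace.expSeries_div_hasSum_exp (s * x * (z - lam))).congr_fun fun n => ?_
    rw [mul_pow (s * (x : ℂ))]; ring
  have h2 : HasSum (fun n : ℕ => (z - lam) ^ n * ((n.factorial : ℂ)⁻¹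
      * iteratedDeriv n (fun z => Complex.exp (s * z ^ 2 * t)) lam))
      (Complex.exp (s * z ^ 2 * t)) := by
    have hd : Differentiable ℂ fun z : ℂ => Complex.exp (s * z ^ 2 * t) := by fun_prop
    refine (Complex.hasSum_taylorSeries_of_entire hd lam z).congr_fun fun n => ?_
    simp only [smul_eq_mul]; ring
  have h3 : HasSum (fun k => ∑ p ∈ Finset.HasAntidiagonal.antidiagonal k,
      ((z - lam) ^ p.1 * ((s * (x : ℂ)) ^ p.1 / (p.1.factorial : ℂ))) *
      ((z - lam) ^ p.2 * ((p.2.factorial : ℂ)⁻¹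
      * iteratedDeriv p.2 (fun z => Complex.exp (s * z ^ 2 * t)) lam)))
      (Complex.exp (s * x * (z - lam)) * Complex.exp (s * z ^ 2 * t)) := by
    rw [← h1.tsum_eq, ← h2.tsum_eq,
      tsum_mul_tsum_eq_tsum_sum_antidiagonal_of_summable_norm h1.summable.norm h2.summable.norm]
    exact (summable_norm_sum_mul_antidiagonal_of_summable_norm h1.summable.norm
      h2.summable.norm).of_norm.hasSum
  have h4 := h3.mul_left (Complex.exp (s * lam * x))
  rw [← Complex.exp_add, ← Complex.exp_add] at h4
  have e : s * lam * x + (s * x * (z - lam) + s * z ^ 2 * t) = s * phase z x t := by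
    simp only [phase]; ring
  rw [e] at h4
  refine h4.congr_fun fun k => ?_
  simp only [expCoeff]
  rw [mul_left_comm, Finset.mul_sum]
  congr 1
  refine Finset.sum_congr rfl fun p hp => ?_
  rw [← Finset.HasAntidiagonal.mem_antidiagonal.1 hp, pow_add]
  ring

lemma contDiff_expCoeff (s lam : ℂ) (t : ℝ) (k : ℕ) :
    ContDiff ℝ ∞ (fun x => expCoeff s lam t x k) := by
  have h : ContDiff ℝ ∞ (fun x : ℝ => (x : ℂ)) := Complex.ofRealCLM.contDiff
  refine (contDiff_const.mul h).cexp.mul (ContDiff.sum fun p _ => ?_)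
  exact (((contDiff_const.mul h).pow _).div_const _).mul contDiff_const

lemma hasDerivAt_expCoeff (s lam : ℂ) (t : ℝ) (k : ℕ) (x : ℝ) :
    HasDerivAt (fun x => expCoeff s lam t x k)
      (s * (lam * expCoeff s lam t x k + prev (expCoeff s lam t x) k)) x := by
  have h : HasDerivAt (fun x : ℝ => (x : ℂ)) 1 x := Complex.ofRealCLM.hasDerivAt
  have hE := (h.const_mul (s * lam)).cexp
  have hA : ∀ i : ℕ, HasDerivAt (fun x : ℝ => (s * (x : ℂ)) ^ (i + 1) / ((i + 1).factorial : ℂ))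
      (s * ((s * (x : ℂ)) ^ i / (i.factorial : ℂ))) x := fun i => by
    refine (((h.const_mul s).pow (i + 1)).div_const _).congr_deriv ?_
    rw [Nat.factorial_succ]
    have : (i.factorial : ℂ) ≠ 0 := by exact_mod_cast i.factorial_ne_zero
    have h' : (i : ℂ) + 1 ≠ 0 := by exact_mod_cast i.succ_ne_zero
    push_cast
    field_simp
  cases k with
  | zero =>
    simp only [expCoeff, Finset.Nat.antidiagonal_zero, Finset.sum_singleton, pow_zero, prev]
    exact (hE.mul_const _).congr_deriv (by ring)
  | succ k =>
    simp only [expCoeff, prev, Finset.Nat.sum_antidiagonal_succ, pow_zero]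
    refine (hE.mul ((HasDerivAt.fun_sum fun p _ => (hA p.1).mul_const _).const_add _)).congr_deriv ?_
    simp only [mul_assoc, ← Finset.mul_sum]
    ring

lemma expType_expCoeff (s lam : ℂ) (t : ℝ) (k : ℕ) :
    ExpType (s * lam).re (fun x => expCoeff s lam t x k) := by
  refine ((ExpType.exp_mul (s * lam)).mul (ExpType.sum (Finset.HasAntidiagonal.antidiagonal k)
    (a := 0) fun p _ => ?_)).mono (add_zero _).le
  have := (ExpType.pow_const_mul s p.1).const_mul (((p.1.factorial : ℂ)⁻¹) *
    ((p.2.factorial : ℂ)⁻¹ * iteratedDeriv p.2 (fun z => Complex.exp (s * z ^ 2 * t)) lam))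
  refine fun b hb => (this b hb).congr_left fun x => ?_
  ring

lemma expType_expCoeff_neg (s lam : ℂ) (t : ℝ) (k : ℕ) :
    ExpType (-(s * lam).re) (fun x => expCoeff s lam t (-x) k) := by
  have h1 := ExpType.exp_mul (-(s * lam))
  refine ((h1.mul (ExpType.sum (Finset.HasAntidiagonal.antidiagonal k) (a := 0) (u := fun p x =>
    (s * ((-x : ℝ) : ℂ)) ^ p.1 / (p.1.factorial : ℂ) * ((p.2.factorial : ℂ)⁻¹ *
      iteratedDeriv p.2 (fun z => Complex.exp (s * z ^ 2 * t)) lam)) fun p _ => ?_)).mono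
      (by simp) : ExpType (-(s * lam).re) _).congr fun x => ?_
  · have := (ExpType.pow_const_mul (-s) p.1).const_mul (((p.1.factorial : ℂ)⁻¹) *
      ((p.2.factorial : ℂ)⁻¹ * iteratedDeriv p.2 (fun z => Complex.exp (s * z ^ 2 * t)) lam))
    refine fun b hb => (this b hb).congr_left fun x => ?_
    push_cast
    ring
  · simp only [expCoeff]
    congr 2
    push_cast
    ring

lemma expCoeff_zero (s lam : ℂ) (t x : ℝ) :
    expCoeff s lam t x 0 = Complex.exp (s * lam * x) * Complex.exp (s * lam ^ 2 * t) := by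
  simp [expCoeff]

/-! ### Reduction to the plane spanned by `e₁` and `(0, c₁, c₂)` -/

/-- The vector `a e₁ + b (0, e)`. -/
def embed (e : Fin 2 → ℂ) (a b : ℂ) : Fin 3 → ℂ := ![a, b * e 0, b * e 1]

/-- `e` is a unit vector of `ℂ²`. -/
def IsUnitVec (e : Fin 2 → ℂ) : Prop := e 0 * star (e 0) + e 1 * star (e 1) = 1

lemma embed_ne_zero {e : Fin 2 → ℂ} (he : IsUnitVec e) {a b : ℂ}
    (h : a * star a + b * star b ≠ 0) : embed e a b ≠ 0 := by
  intro h0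
  have h1 : a = 0 := congrFun h0 0
  have h2 : b * e 0 = 0 := congrFun h0 1
  have h3 : b * e 1 = 0 := congrFun h0 2
  apply h
  have h4 : b = 0 := by
    rw [IsUnitVec] at he
    linear_combination (star (e 0)) * h2 + (star (e 1)) * h3 - b * he
  simp [h1, h4]

lemma star_dotProduct_embed {e : Fin 2 → ℂ} (he : IsUnitVec e) (a b : ℂ) :
    star (embed e a b) ⬝ᵥ embed e a b = a * star a + b * star b := by
  rw [IsUnitVec] at he
  simp only [dotProduct, Fin.sum_univ_three, embed, Pi.star_apply, Matrix.cons_val_zero,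
    Matrix.cons_val_one, Matrix.cons_val, star_mul']
  linear_combination (b * star b) * he

lemma lineProj_embed_mulVec {e : Fin 2 → ℂ} (he : IsUnitVec e) (w : CoeffPair) (x y : ℂ) :
    (lineProj (embed e (w.1 0) (w.2 0))).mulVec (embed e x y)
      = embed e (projDiag w * x + projOff w * y)
        (projDiag w.swap * y + projOff w.swap * x) := by
  simp only [projDiag, projOff, Prod.fst_swap, Prod.snd_swap, gram]
  generalize w.1 0 = a
  generalize w.2 0 = b
  rw [lineProj, star_dotProduct_embed he, Matrix.smul_mulVec, Matrix.vecMulVec_mulVec]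
  have e1 : star (embed e a b) ⬝ᵥ embed e x y = star a * x + star b * y := by
    rw [IsUnitVec] at he
    simp only [dotProduct, Fin.sum_univ_three, embed, Pi.star_apply, Matrix.cons_val_zero,
      Matrix.cons_val_one, Matrix.cons_val, star_mul']
    linear_combination (star b * y) * he
  rw [e1]
  ext i
  fin_cases i <;> simp [embed] <;> ring

lemma lineProj_embed_apply {e : Fin 2 → ℂ} (he : IsUnitVec e) (a b : ℂ) (l : Fin 2) :
    lineProj (embed e a b) 0 l.succ
      = a * star b / (a * star a + b * star b) * star (e l) := by
  rw [lineProj, star_dotProduct_embed he, Matrix.smul_apply, Matrix.vecMulVec_apply]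
  fin_cases l <;> simp [embed] <;> ring

lemma lineProj_mul_self {v : Fin 3 → ℂ} (h : star v ⬝ᵥ v ≠ 0) :
    lineProj v * lineProj v = lineProj v := by
  rw [lineProj, Matrix.smul_mul, Matrix.mul_smul, Matrix.vecMulVec_mul_vecMulVec]
  rw [Matrix.vecMulVec_smul, smul_smul, smul_smul]
  congr 1
  field_simp

lemma lineProj_mulVec_self {v : Fin 3 → ℂ} (h : star v ⬝ᵥ v ≠ 0) :
    (lineProj v).mulVec v = v := by
  rw [lineProj, Matrix.smul_mulVec, Matrix.vecMulVec_mulVec]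
  ext i
  simp
  field_simp

lemma darbouxFactor_inv {lam z : ℂ} (h1 : z ≠ lam) (h2 : z ≠ star lam)
    {P : Matrix (Fin 3) (Fin 3) ℂ} (hP : P * P = P) :
    darbouxFactor lam P z * (1 + ((lam - star lam) / (z - lam)) • P) = 1 := by
  have h1' := sub_ne_zero.2 h1
  have h2' := sub_ne_zero.2 h2
  rw [darbouxFactor, sub_mul, mul_add, mul_add, Matrix.smul_mul, Matrix.smul_mul,
    mul_smul_comm, mul_smul_comm, hP, mul_one, mul_one, one_mul,
    smul_smul, add_sub_assoc, ← add_smul,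
    ← sub_smul]
  have : (lam - star lam) / (z - lam) - ((lam - star lam) / (z - star lam) +
    (lam - star lam) / (z - star lam) * ((lam - star lam) / (z - lam))) = 0 := by
    field_simp
    ring
  rw [this, zero_smul, add_zero]

/-- Filling in the value `a 0` at `lam` gives an analytic, hence continuous, function. -/
lemma tendsto_of_hasSum {lam : ℂ} {a : ℕ → ℂ} {A : ℂ → ℂ}
    (h : ∀ᶠ z in 𝓝[≠] lam, HasSum (fun k => (z - lam) ^ k * a k) (A z)) :
    Tendsto A (𝓝[≠] lam) (𝓝 (a 0)) := by
  have hs : HasFPowerSeriesAt (Function.update A lam (a 0)) (FormalMultilinearSeries.ofScalars ℂ a)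
      lam := by
    rw [hasFPowerSeriesAt_iff]
    rw [eventually_nhdsWithin_iff] at h
    have ht : Tendsto (fun z : ℂ => lam + z) (𝓝 0) (𝓝 lam) := by
      have := (by fun_prop : Continuous fun z : ℂ => lam + z).tendsto 0
      rwa [add_zero] at this
    filter_upwards [ht.eventually h] with z hz
    by_cases h0 : z = 0
    · subst h0
      simp only [add_zero, Function.update_self]
      have := hasSum_single (f := fun n : ℕ => (0 : ℂ) ^ n •
        (FormalMultilinearSeries.ofScalars ℂ a).coeff n) 0 (fun n hn => by simp [hn])
      simpa using this
    · rw [Function.update_of_ne (by simpa using h0)]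
      simpa using hz (by simpa using h0)
  exact continuousAt_update_same.1 hs.continuousAt

/-- The Taylor coefficients at `lam` of the vacuum wave applied to `e₁ + κ (0, e)`. -/
def vacuumCoeff (lam κ : ℂ) (t x : ℝ) : CoeffPair :=
  (expCoeff (-Complex.I) lam t x, fun k => κ * expCoeff Complex.I lam t x k)

lemma gram_vacuumCoeff_ne_zero (lam κ : ℂ) (t x : ℝ) : gram (vacuumCoeff lam κ t x) ≠ 0 := by
  intro h
  have := ((gram_eq_zero_iff _).1 h).1
  simp [vacuumCoeff, expCoeff_zero] at this

/-- Dividing by `y = z - lam` shifts the coefficients once the constant terms are removed; the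
combination of constant terms that occurs is zero by `proj_annihilates`. -/
lemma hasSum_dressFst {ν y A B : ℂ} (hy : y ≠ 0) {w : CoeffPair} (hw : gram w ≠ 0)
    (hA : HasSum (fun k => y ^ k * w.1 k) A) (hB : HasSum (fun k => y ^ k * w.2 k) B) :
    HasSum (fun k => y ^ k * dressFst ν w k)
      (A + ν / y * (A - (projDiag w * A + projOff w * B))) := by
  have hA' := ((hasSum_nat_add_iff' 1).2 hA).mul_left (ν / y * projDiag w.swap)
  have hB' := ((hasSum_nat_add_iff' 1).2 hB).mul_left (ν / y * projOff w)
  have h := hA.add (hA'.sub hB')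
  have e : A + (ν / y * projDiag w.swap * (A - ∑ i ∈ Finset.range 1, y ^ i * w.1 i)
      - ν / y * projOff w * (B - ∑ i ∈ Finset.range 1, y ^ i * w.2 i))
      = A + ν / y * (A - (projDiag w * A + projOff w * B)) := by
    have e0 := proj_annihilates w
    simp only [Finset.range_one, Finset.sum_singleton, pow_zero, one_mul]
    rw [projDiag_swap hw] at e0 ⊢
    linear_combination (-(ν / y)) * e0
  rw [e] at h
  refine h.congr_fun fun k => ?_
  rw [dressFst]
  field_simp
  ring

/-! ### Expansion of the dressed wave functions at `lam` -/

section Spectral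

variable {lam c₁ c₂ κ : ℂ} {e : Fin 2 → ℂ}

/-- The waves lie in the plane of `e₁` and `(0, e)`, with prescribed Taylor expansions at `lam`. -/
def HasExpansion (lam c₁ c₂ : ℂ) (e : Fin 2 → ℂ) (j : ℕ) (x t : ℝ) (w : CoeffPair) : Prop :=
  ∀ z, z ≠ lam → z ≠ star lam → ∃ A B,
    (waveFun lam c₁ c₂ j z x t).mulVec (dressingVec c₁ c₂) = embed e A B ∧
    HasSum (fun k => (z - lam) ^ k * w.1 k) A ∧ HasSum (fun k => (z - lam) ^ k * w.2 k) B

lemma eventually_ne_ne (hlam : 0 < lam.im) : ∀ᶠ z in 𝓝[≠] lam, z ≠ lam ∧ z ≠ star lam := by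
  have : lam ≠ star lam := fun h => by
    have := congrArg Complex.im h
    simp at this
    linarith
  filter_upwards [self_mem_nhdsWithin, nhdsWithin_le_nhds (isOpen_ne.mem_nhds this)] with z h1 h2
  exact ⟨h1, h2⟩

lemma HasExpansion.tendsto (hlam : 0 < lam.im) {j : ℕ} {x t : ℝ} {w : CoeffPair}
    (h : HasExpansion lam c₁ c₂ e j x t w) :
    Tendsto (fun z => (waveFun lam c₁ c₂ j z x t).mulVec (dressingVec c₁ c₂)) (𝓝[≠] lam)
      (𝓝 (embed e (w.1 0) (w.2 0))) := by
  choose! A B hAB hA hB using h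
  have hA' : Tendsto A (𝓝[≠] lam) (𝓝 (w.1 0)) := tendsto_of_hasSum <| by
    filter_upwards [eventually_ne_ne hlam] with z hz using hA z hz.1 hz.2
  have hB' : Tendsto B (𝓝[≠] lam) (𝓝 (w.2 0)) := tendsto_of_hasSum <| by
    filter_upwards [eventually_ne_ne hlam] with z hz using hB z hz.1 hz.2
  have hE : Tendsto (fun z => embed e (A z) (B z)) (𝓝[≠] lam) (𝓝 (embed e (w.1 0) (w.2 0))) := by
    rw [tendsto_pi_nhds]
    intro i
    fin_cases i
    · exact hA'
    · exact hB'.mul_const _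
    · exact hB'.mul_const _
  refine hE.congr' ?_
  filter_upwards [eventually_ne_ne hlam] with z hz using (hAB z hz.1 hz.2).symm

lemma HasExpansion.waveProj_eq (hlam : 0 < lam.im) {j : ℕ} {x t : ℝ} {w : CoeffPair}
    (h : HasExpansion lam c₁ c₂ e j x t w) :
    waveProj lam (dressingVec c₁ c₂) (waveFun lam c₁ c₂ j) x t
      = lineProj (embed e (w.1 0) (w.2 0)) := by
  rw [waveProj, (h.tendsto hlam).limUnder_eq]

lemma waveProj_origin (hlam : 0 < lam.im) {j : ℕ}
    (h : ∀ z, z ≠ lam → z ≠ star lam → waveFun lam c₁ c₂ j z 0 0 = 1) :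
    waveProj lam (dressingVec c₁ c₂) (waveFun lam c₁ c₂ j) 0 0
      = lineProj (dressingVec c₁ c₂) := by
  rw [waveProj]
  congr 1
  refine Tendsto.limUnder_eq (tendsto_const_nhds.congr' ?_)
  filter_upwards [eventually_ne_ne hlam] with z hz
  rw [h z hz.1 hz.2, Matrix.one_mulVec]

open scoped ComplexOrder in
lemma dressingVec_ne (c₁ c₂ : ℂ) : star (dressingVec c₁ c₂) ⬝ᵥ dressingVec c₁ c₂ ≠ 0 := by
  rw [Ne, dotProduct_star_self_eq_zero]
  exact fun h => one_ne_zero (congrFun h 0)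

lemma waveFun_origin (hlam : 0 < lam.im) (j : ℕ) (z : ℂ) (h1 : z ≠ lam) (h2 : z ≠ star lam) :
    waveFun lam c₁ c₂ j z 0 0 = 1 := by
  induction j generalizing z with
  | zero =>
    ext i k
    fin_cases i <;> fin_cases k <;> simp [waveFun, vacuumWave, phase]
  | succ j ih =>
    change darbouxFactor _ _ _ * waveFun lam c₁ c₂ j z 0 0 * _⁻¹ = 1
    rw [ih z h1 h2, mul_one, waveProj_origin hlam fun z => ih z]
    have := darbouxFactor_inv h1 h2 (lineProj_mul_self (dressingVec_ne c₁ c₂))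
    rw [Matrix.inv_eq_right_inv this, this]

/-- At the origin every wave function is `1`, so `P` projects onto the dressing vector itself. That
vector is therefore an eigenvector of the inverse factor, with eigenvalue `1 + ν / (z - lam)`. -/
lemma inv_darbouxFactor_mulVec (hlam : 0 < lam.im) (j : ℕ) {z : ℂ} (h1 : z ≠ lam)
    (h2 : z ≠ star lam) :
    ((darbouxFactor lam (waveProj lam (dressingVec c₁ c₂) (waveFun lam c₁ c₂ j) 0 0) z)⁻¹).mulVec
      (dressingVec c₁ c₂) = ((z - star lam) / (z - lam)) • dressingVec c₁ c₂ := by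
  rw [waveProj_origin hlam (waveFun_origin hlam j), Matrix.inv_eq_right_inv
    (darbouxFactor_inv h1 h2 (lineProj_mul_self (dressingVec_ne c₁ c₂))), Matrix.add_mulVec,
    Matrix.one_mulVec, Matrix.smul_mulVec, lineProj_mulVec_self (dressingVec_ne c₁ c₂)]
  have h1' := sub_ne_zero.2 h1
  ext i
  simp only [Pi.add_apply, Pi.smul_apply, smul_eq_mul]
  field_simp
  ring

lemma hasExpansion (hlam : 0 < lam.im) (he : IsUnitVec e)
    (hc : dressingVec c₁ c₂ = embed e 1 κ) (j : ℕ) (x t : ℝ) :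
    HasExpansion lam c₁ c₂ e j x t ((dress (lam - star lam))^[j] (vacuumCoeff lam κ t x)) := by
  induction j with
  | zero =>
    intro z h1 h2
    refine ⟨Complex.exp (-Complex.I * phase z x t), κ * Complex.exp (Complex.I * phase z x t), ?_,
      hasSum_expCoeff _ _ _ _ _, ?_⟩
    · rw [hc, waveFun, vacuumWave]
      ext i
      fin_cases i <;> simp [embed, Matrix.mulVec_diagonal] <;> ring
    · refine ((hasSum_expCoeff Complex.I lam t x z).mul_left κ).congr_fun fun k => ?_
      simp only [vacuumCoeff, Function.iterate_zero, id]
      ring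
  | succ j ih =>
    intro z h1 h2
    obtain ⟨A, B, hAB, hA, hB⟩ := ih z h1 h2
    have hw := gram_iterate_ne_zero (lam - star lam) (gram_vacuumCoeff_ne_zero lam κ t x) j
    rw [Function.iterate_succ_apply']
    have hP := ih.waveProj_eq hlam
    set w := (dress (lam - star lam))^[j] (vacuumCoeff lam κ t x) with hwdef
    have h1' := sub_ne_zero.2 h1
    have h2' := sub_ne_zero.2 h2
    refine ⟨_, _, ?_, hasSum_dressFst h1' hw hA hB, hasSum_dressFst (w := w.swap) h1'
      (by rwa [gram_swap]) hB hA⟩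
    rw [waveFun, ← Matrix.mulVec_mulVec, ← Matrix.mulVec_mulVec, inv_darbouxFactor_mulVec hlam j h1 h2,
      Matrix.mulVec_smul, hAB, Matrix.mulVec_smul, hP, darbouxFactor, Matrix.sub_mulVec,
      Matrix.one_mulVec, Matrix.smul_mulVec, lineProj_embed_mulVec he]
    generalize projDiag w = p, projOff w = r, projDiag w.swap = p', projOff w.swap = r'
    generalize star lam = a at *
    ext i
    fin_cases i <;> simp [embed] <;> field_simp <;> ring

lemma solitonPotential_apply (hlam : 0 < lam.im) (he : IsUnitVec e)
    (hc : dressingVec c₁ c₂ = embed e 1 κ) (N : ℕ) (t : ℝ) (l : Fin 2) (x : ℝ) :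
    soliton lam c₁ c₂ N t l x
      = scalarPot (lam - star lam) (vacuumCoeff lam κ t x) N * star (e l) := by
  rw [soliton, solitonPotential, scalarPot, Matrix.smul_apply, Matrix.sum_apply, smul_eq_mul,
    mul_comm (2 : ℂ), mul_assoc (lam - star lam), mul_assoc (lam - star lam), mul_assoc (2 : ℂ)]
  congr 1
  rw [Finset.sum_mul, Finset.mul_sum]
  refine Finset.sum_congr rfl fun j _ => ?_
  rw [(hasExpansion hlam he hc j x t).waveProj_eq hlam, sigma3, Matrix.sub_apply,
    Matrix.diagonal_mul, Matrix.mul_diagonal, lineProj_embed_apply he]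
  simp only [projOff, gram]
  fin_cases l <;> simp [-RCLike.star_def] <;> ring

end Spectral

/-! ### Power series depending on a parameter -/

/-- Coefficientwise derivative of a power series depending on a real parameter. -/
def SeriesDeriv (A A' : ℝ → PowerSeries ℂ) : Prop :=
  ∀ n x, HasDerivAt (fun y => PowerSeries.coeff n (A y)) (PowerSeries.coeff n (A' x)) x

/-- Coefficientwise convergence of power series. -/
def SeriesTendsto (A : ℝ → PowerSeries ℂ) (l : Filter ℝ) (a : PowerSeries ℂ) : Prop :=
  ∀ n, Tendsto (fun x => PowerSeries.coeff n (A x)) l (𝓝 (PowerSeries.coeff n a))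

namespace SeriesDeriv

variable {A A' B B' : ℝ → PowerSeries ℂ}

lemma const (a : PowerSeries ℂ) : SeriesDeriv (fun _ => a) (fun _ => 0) := fun n x => by
  simpa using hasDerivAt_const x (PowerSeries.coeff n a)

lemma C {u u' : ℝ → ℂ} (h : ∀ x, HasDerivAt u (u' x) x) :
    SeriesDeriv (fun x => PowerSeries.C (u x)) (fun x => PowerSeries.C (u' x)) := fun n x => by
  simp only [PowerSeries.coeff_C]
  split_ifs
  · exact h x
  · exact hasDerivAt_const x _

lemma add (hA : SeriesDeriv A A') (hB : SeriesDeriv B B') :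
    SeriesDeriv (fun x => A x + B x) (fun x => A' x + B' x) := fun n x => by
  simpa only [map_add] using (hA n x).fun_add (hB n x)

lemma sub (hA : SeriesDeriv A A') (hB : SeriesDeriv B B') :
    SeriesDeriv (fun x => A x - B x) (fun x => A' x - B' x) := fun n x => by
  simpa only [map_sub] using (hA n x).fun_sub (hB n x)

lemma mul (hA : SeriesDeriv A A') (hB : SeriesDeriv B B') :
    SeriesDeriv (fun x => A x * B x) (fun x => A' x * B x + A x * B' x) := fun n x => by
  simp only [map_add, PowerSeries.coeff_mul, ← Finset.sum_add_distrib]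
  exact HasDerivAt.fun_sum fun p _ => (hA p.1 x).fun_mul (hB p.2 x)

lemma X_mul_derivative (hA : SeriesDeriv A A') :
    SeriesDeriv (fun x => PowerSeries.X * PowerSeries.derivative ℂ (A x))
      (fun x => PowerSeries.X * PowerSeries.derivative ℂ (A' x)) := fun n x => by
  cases n with
  | zero => simpa using hasDerivAt_const x (0 : ℂ)
  | succ n =>
    simp only [PowerSeries.coeff_succ_X_mul, PowerSeries.coeff_derivative]
    exact (hA (n + 1) x).mul_const _

lemma congr_deriv (hA : SeriesDeriv A A') (h : ∀ x, A' x = B' x) : SeriesDeriv A B' :=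
  (funext h : A' = B') ▸ hA

lemma unique (hA : SeriesDeriv A A') (hB : SeriesDeriv A B') (x : ℝ) : A' x = B' x := by
  ext n
  exact (hA n x).unique (hB n x)

lemma inv (hA : SeriesDeriv A A') (h1 : ∀ x, PowerSeries.constantCoeff (A x) = 1) :
    SeriesDeriv (fun x => (A x)⁻¹) (fun x => -A' x * (A x)⁻¹ * (A x)⁻¹) := by
  -- The recursion for the coefficients of an inverse gives differentiability; the formula then
  -- follows by differentiating `A * A⁻¹ = 1`.
  have hd : ∀ n x, DifferentiableAt ℝ (fun y => PowerSeries.coeff n (A y)⁻¹) x := by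
    intro n
    induction n using Nat.strong_induction_on with
    | _ n ih =>
      intro x
      simp only [PowerSeries.coeff_inv n, h1]
      split_ifs
      · exact differentiableAt_const _
      · refine DifferentiableAt.const_mul (DifferentiableAt.fun_sum fun p _ => ?_) _
        split_ifs with hp
        · exact (hA p.1 x).differentiableAt.fun_mul (ih p.2 hp x)
        · exact differentiableAt_const _
  have hB : SeriesDeriv (fun x => (A x)⁻¹)
      (fun x => PowerSeries.mk fun n => deriv (fun y => PowerSeries.coeff n (A y)⁻¹) x) :=
    fun n x => by simpa only [PowerSeries.coeff_mk] using (hd n x).hasDerivAt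
  have hinv : ∀ x, A x * (A x)⁻¹ = 1 := fun x => PowerSeries.mul_inv_cancel _ (by simp [h1])
  have hAB := hA.mul hB
  simp only [hinv] at hAB
  have e := fun x => hAB.unique (const 1) x
  refine hB.congr_deriv fun x => ?_
  have e1 := e x
  have e2 := hinv x
  generalize PowerSeries.mk _ = D at *
  linear_combination (-D) * e2 + (A x)⁻¹ * e1

end SeriesDeriv

namespace SeriesTendsto

variable {A B : ℝ → PowerSeries ℂ} {a b : PowerSeries ℂ} {l : Filter ℝ}

lemma congr_lim (hA : SeriesTendsto A l a) (h : a = b) : SeriesTendsto A l b := h ▸ hA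

lemma const (a : PowerSeries ℂ) : SeriesTendsto (fun _ => a) l a := fun _ => tendsto_const_nhds

lemma C {u : ℝ → ℂ} {c : ℂ} (h : Tendsto u l (𝓝 c)) :
    SeriesTendsto (fun x => PowerSeries.C (u x)) l (PowerSeries.C c) := fun n => by
  simp only [PowerSeries.coeff_C]
  split_ifs
  · exact h
  · exact tendsto_const_nhds

lemma add (hA : SeriesTendsto A l a) (hB : SeriesTendsto B l b) :
    SeriesTendsto (fun x => A x + B x) l (a + b) := fun n => by
  simpa only [map_add] using (hA n).add (hB n)

lemma sub (hA : SeriesTendsto A l a) (hB : SeriesTendsto B l b) :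
    SeriesTendsto (fun x => A x - B x) l (a - b) := fun n => by
  simpa only [map_sub] using (hA n).sub (hB n)

lemma mul (hA : SeriesTendsto A l a) (hB : SeriesTendsto B l b) :
    SeriesTendsto (fun x => A x * B x) l (a * b) := fun n => by
  simp only [PowerSeries.coeff_mul]
  exact tendsto_finsetSum _ fun p _ => (hA p.1).mul (hB p.2)

lemma X_mul_derivative (hA : SeriesTendsto A l a) :
    SeriesTendsto (fun x => PowerSeries.X * PowerSeries.derivative ℂ (A x)) l
      (PowerSeries.X * PowerSeries.derivative ℂ a) := fun n => by
  cases n with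
  | zero => simpa using tendsto_const_nhds
  | succ n =>
    simp only [PowerSeries.coeff_succ_X_mul, PowerSeries.coeff_derivative]
    exact (hA (n + 1)).mul_const _

lemma inv (hA : SeriesTendsto A l a) (h1 : ∀ x, PowerSeries.constantCoeff (A x) = 1)
    (h2 : PowerSeries.constantCoeff a = 1) : SeriesTendsto (fun x => (A x)⁻¹) l a⁻¹ := by
  intro n
  induction n using Nat.strong_induction_on with
  | _ n ih =>
    simp only [PowerSeries.coeff_inv n, h1, h2]
    split_ifs
    · exact tendsto_const_nhds
    · refine Tendsto.const_mul _ (tendsto_finsetSum _ fun p _ => ?_)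
      split_ifs with hp
      · exact (hA p.1).mul (ih p.2 hp)
      · exact tendsto_const_nhds

end SeriesTendsto

/-! ### The dressed formal solution at `λ = ∞`, as a power series in `1 / λ` -/

open PowerSeries (X C)

/-- The geometric series `1 / (1 - a X)`. -/
def geom (a : ℂ) : PowerSeries ℂ := PowerSeries.mk fun n => a ^ n

lemma one_sub_mul_geom (a : ℂ) : (1 - C a * X) * geom a = 1 := by
  ext n
  cases n with
  | zero => simp [geom]
  | succ n =>
    rw [sub_mul, one_mul, mul_assoc, map_sub, PowerSeries.coeff_C_mul, PowerSeries.coeff_succ_X_mul]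
    simp [geom, PowerSeries.coeff_one, pow_succ']

/-- The first column of the product of the first `j` Darboux factors, expanded in `1 / λ`. -/
def dressSeries (lam : ℂ) (w : CoeffPair) : ℕ → PowerSeries ℂ × PowerSeries ℂ
  | 0 => (1, 0)
  | j + 1 =>
    ((dressSeries lam w j).1 - C (lam - star lam) * (X * geom (star lam)) *
        (C (projDiag ((dress (lam - star lam))^[j] w)) * (dressSeries lam w j).1
          + C (projOff ((dress (lam - star lam))^[j] w)) * (dressSeries lam w j).2),
      (dressSeries lam w j).2 - C (lam - star lam) * (X * geom (star lam)) *
        (C (star (projOff ((dress (lam - star lam))^[j] w))) * (dressSeries lam w j).1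
          + C (1 - projDiag ((dress (lam - star lam))^[j] w)) * (dressSeries lam w j).2))

lemma constantCoeff_dressSeries (lam : ℂ) (w : CoeffPair) (j : ℕ) :
    PowerSeries.constantCoeff (dressSeries lam w j).1 = 1 := by
  induction j with
  | zero => simp [dressSeries]
  | succ j ih => simp [dressSeries, ih]

/-- `(F, G)` is a formal solution at `λ = ∞` of the spatial Lax equation with potential `u`. -/
structure FormalSolution (u : ℝ → ℂ) (F G : ℝ → PowerSeries ℂ) : Prop where
  fst : SeriesDeriv F (fun x => -C Complex.I * C (u x) * G x)
  snd : ∃ H, SeriesDeriv G H ∧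
    ∀ x, X * H x = 2 * C Complex.I * G x - C Complex.I * C (star (u x)) * X * F x

/-- Each Darboux factor intertwines the Lax operators of the old and new potentials. As identities
of power series this uses the equations for `P`, the relation `P² = P` and the inverse property of
`geom`. -/
lemma dressSeries_formalSolution {lam : ℂ} {w : ℝ → CoeffPair}
    (h : IsWave (-Complex.I) lam (fun _ => 0) w) (hw : ∀ x, gram (w x) ≠ 0) (j : ℕ) :
    FormalSolution (fun x => scalarPot (lam - star lam) (w x) j)
      (fun x => (dressSeries lam (w x) j).1) (fun x => (dressSeries lam (w x) j).2) := by
  have hs : star (-Complex.I) = - -Complex.I := by simp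
  induction j with
  | zero =>
    refine ⟨?_, fun _ => 0, SeriesDeriv.const 0, fun x => ?_⟩
    · simpa [scalarPot, dressSeries] using SeriesDeriv.const 1
    · simp [scalarPot, dressSeries]
  | succ j ih =>
    obtain ⟨hF, H, hG, hH⟩ := ih
    have hwj : ∀ x, gram ((dress (lam - star lam))^[j] (w x)) ≠ 0 := fun x =>
      gram_iterate_ne_zero _ (hw x) j
    have hW := h.iterate_dress hs hw j
    have hp := hW.hasDerivAt_projDiag hs hwj
    have hr := hW.hasDerivAt_projOff hs hwj
    have hrs := fun x => (hr x).star
    have hq := fun x => (hp x).const_sub 1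
    have hcst := SeriesDeriv.const (C (lam - star lam) * (X * geom (star lam)))
    have hF' := hF.sub (hcst.mul (((SeriesDeriv.C hp).mul hF).add ((SeriesDeriv.C hr).mul hG)))
    have hG' := hG.sub (hcst.mul (((SeriesDeriv.C hrs).mul hF).add ((SeriesDeriv.C hq).mul hG)))
    have hu : ∀ x, scalarPot (lam - star lam) (w x) (j + 1) = scalarPot (lam - star lam) (w x) j
        + 2 * (lam - star lam) * projOff ((dress (lam - star lam))^[j] (w x)) := fun x => by
      simp only [scalarPot, Finset.sum_range_succ, mul_add]
    refine ⟨?_, _, hG', fun x => ?_⟩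
    · refine hF'.congr_deriv fun x => ?_
      -- The derivative of `G` is known only through `X * H`, since the Lax equation contains `λ = 1
      -- / X`.
      refine mul_left_cancel₀ PowerSeries.X_ne_zero ?_
      have e1 := one_sub_mul_geom (star lam)
      have e2 := hH x
      have e3 := congrArg (C (R := ℂ)) (projOff_mul_star (hwj x))
      simp only [hu, dressSeries, map_add, map_sub, map_mul, map_neg, map_one, map_ofNat] at e1 e2 e3 ⊢
      generalize C (projDiag _) = p, C (projOff _) = r, C (star (projOff _)) = r' at e1 e2 e3 ⊢
      generalize C lam = L, C (star lam) = a, geom (star lam) = g at e1 e2 e3 ⊢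
      linear_combination (-(L - a) * X * g * r) * e2
        - (2 * C Complex.I * (L - a) * r * X * (dressSeries lam (w x) j).2) * e1
        - (2 * C Complex.I * (L - a) ^ 2 * X ^ 2 * g * (dressSeries lam (w x) j).1) * e3
    · have e1 := one_sub_mul_geom (star lam)
      have e2 := hH x
      have e3 := congrArg (C (R := ℂ)) (projOff_mul_star (hwj x))
      have hI : star Complex.I = -Complex.I := Complex.conj_I
      simp only [hu, dressSeries, map_add, map_sub, map_mul, map_neg, map_one, map_ofNat, star_add,
        star_mul', star_sub, star_star, star_ofNat, star_neg, star_one, star_projDiag, hI,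
        neg_neg] at e1 e2 e3 ⊢
      generalize C (projDiag _) = p, C (projOff _) = r, C (star (projOff _)) = r' at e1 e2 e3 ⊢
      generalize C lam = L, C (star lam) = a, geom (star lam) = g at e1 e2 e3 ⊢
      linear_combination (1 - (L - a) * X * g * (1 - p)) * e2
        + (2 * C Complex.I * (L - a) * r' * X * (dressSeries lam (w x) j).1) * e1
        + (2 * C Complex.I * (L - a) ^ 2 * X ^ 2 * g * (dressSeries lam (w x) j).2) * e3

/-! ### Limits of the formal solution -/

lemma dressSeries_tendsto {lam ε : ℂ} {w : ℝ → CoeffPair} {l : Filter ℝ}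
    (hp : ∀ j, Tendsto (fun x => projDiag ((dress (lam - star lam))^[j] (w x))) l (𝓝 ε))
    (hr : ∀ j, Tendsto (fun x => projOff ((dress (lam - star lam))^[j] (w x))) l (𝓝 0)) (j : ℕ) :
    SeriesTendsto (fun x => (dressSeries lam (w x) j).1) l
        ((1 - C ((lam - star lam) * ε) * (X * geom (star lam))) ^ j) ∧
      SeriesTendsto (fun x => (dressSeries lam (w x) j).2) l 0 := by
  induction j with
  | zero => exact ⟨by simpa [dressSeries] using SeriesTendsto.const 1, SeriesTendsto.const 0⟩
  | succ j ih =>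
    obtain ⟨hF, hG⟩ := ih
    have hcst := SeriesTendsto.const (l := l) (C (lam - star lam) * (X * geom (star lam)))
    have hP := SeriesTendsto.C (hp j)
    have hQ := SeriesTendsto.C ((hp j).const_sub 1)
    have hR := SeriesTendsto.C (hr j)
    have hS := SeriesTendsto.C (hr j).star
    constructor
    · refine (hF.sub (hcst.mul ((hP.mul hF).add (hR.mul hG)))).congr_lim ?_
      rw [map_mul]
      ring
    · refine (hG.sub (hcst.mul ((hS.mul hF).add (hQ.mul hG)))).congr_lim ?_
      simp

/-! ### The Riccati equation and the conserved densities -/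

namespace FormalSolution

variable {u : ℝ → ℂ} {F G : ℝ → PowerSeries ℂ}

/-- The ratio of the components solves the Riccati equation. -/
lemma riccati (h : FormalSolution u F G) (h1 : ∀ x, PowerSeries.constantCoeff (F x) = 1) :
    ∃ D, SeriesDeriv (fun x => G x * (F x)⁻¹) D ∧ ∀ x, X * D x
      = 2 * C Complex.I * (G x * (F x)⁻¹) - C Complex.I * C (star (u x)) * X
        + C Complex.I * C (u x) * X * (G x * (F x)⁻¹) ^ 2 := by
  obtain ⟨hF, H, hG, hH⟩ := h
  refine ⟨_, hG.mul (hF.inv h1), fun x => ?_⟩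
  have e1 : F x * (F x)⁻¹ = 1 := PowerSeries.mul_inv_cancel _ (by simp [h1])
  have e2 := hH x
  linear_combination (F x)⁻¹ * e2 - (C Complex.I * C (star (u x)) * X) * e1

/-- The logarithmic derivative in the spectral variable is a primitive of the densities. -/
lemma logDeriv (h : FormalSolution u F G) (h1 : ∀ x, PowerSeries.constantCoeff (F x) = 1) :
    SeriesDeriv (fun x => X * PowerSeries.derivative ℂ (F x) * (F x)⁻¹)
      (fun x => X * PowerSeries.derivative ℂ (-C Complex.I * C (u x) * (G x * (F x)⁻¹))) := by
  refine (h.fst.X_mul_derivative.mul (h.fst.inv h1)).congr_deriv fun x => ?_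
  have e1 : F x * (F x)⁻¹ = 1 := PowerSeries.mul_inv_cancel _ (by simp [h1])
  have e2 : G x = F x * (G x * (F x)⁻¹) := by linear_combination (-G x) * e1
  have hC : ∀ K : PowerSeries ℂ, PowerSeries.derivative ℂ (-C Complex.I * C (u x) * K)
      = -C Complex.I * C (u x) * PowerSeries.derivative ℂ K := fun K => by
    rw [← map_neg, ← map_mul, Derivation.leibniz]
    simp
  -- With `G = F ξ`, the terms containing the `X`-derivative of `F` cancel, leaving only that of
  -- `ξ`.
  have e3 : PowerSeries.derivative ℂ (G x) = PowerSeries.derivative ℂ (F x) * (G x * (F x)⁻¹)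
      + F x * PowerSeries.derivative ℂ (G x * (F x)⁻¹) := by
    conv_lhs => rw [e2]
    rw [Derivation.leibniz]
    simp only [smul_eq_mul]
    ring
  rw [hC, hC, e3]
  generalize PowerSeries.derivative ℂ (G x * (F x)⁻¹) = K
  linear_combination (-X * C Complex.I * C (u x) * K) * e1

end FormalSolution

section RiccatiCoeff

variable {u : ℝ → ℂ} {ξ D : ℝ → PowerSeries ℂ}

lemma riccati_coeff_zero (hD : ∀ x, X * D x = 2 * C Complex.I * ξ x
      - C Complex.I * C (star (u x)) * X + C Complex.I * C (u x) * X * ξ x ^ 2) (x : ℝ) :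
    PowerSeries.coeff 0 (ξ x) = 0 := by
  have e : X * D x = C (2 * Complex.I) * ξ x - C (Complex.I * star (u x)) * X
      + C (Complex.I * u x) * (X * ξ x ^ 2) := by
    simp only [hD, map_mul, map_ofNat]; ring
  simpa using congrArg (PowerSeries.coeff 0) e

lemma riccati_coeff (hD : ∀ x, X * D x = 2 * C Complex.I * ξ x
      - C Complex.I * C (star (u x)) * X + C Complex.I * C (u x) * X * ξ x ^ 2) (n : ℕ) (x : ℝ) :
    PowerSeries.coeff n (D x) = 2 * Complex.I * PowerSeries.coeff (n + 1) (ξ x)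
      - (if n = 0 then Complex.I * star (u x) else 0)
      + Complex.I * u x * PowerSeries.coeff n (ξ x ^ 2) := by
  have e : X * D x = C (2 * Complex.I) * ξ x - C (Complex.I * star (u x)) * X
      + C (Complex.I * u x) * (X * ξ x ^ 2) := by
    simp only [hD, map_mul, map_ofNat]; ring
  have := congrArg (PowerSeries.coeff (n + 1)) e
  rw [map_add, map_sub, PowerSeries.coeff_succ_X_mul, PowerSeries.coeff_C_mul,
    PowerSeries.coeff_C_mul, PowerSeries.coeff_C_mul, PowerSeries.coeff_succ_X_mul,
    PowerSeries.coeff_X] at this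
  rw [this]
  simp

lemma riccati_coeff_one (hξ : SeriesDeriv ξ D) (hD : ∀ x, X * D x = 2 * C Complex.I * ξ x
      - C Complex.I * C (star (u x)) * X + C Complex.I * C (u x) * X * ξ x ^ 2) (x : ℝ) :
    PowerSeries.coeff 1 (ξ x) = star (u x) / 2 := by
  have h0 := riccati_coeff_zero hD
  have h1 := (hξ 0 x).unique ((hasDerivAt_const x (0 : ℂ)).congr_of_eventuallyEq
    (Eventually.of_forall h0))
  have h2 : PowerSeries.coeff 0 (ξ x ^ 2) = 0 := by
    have := h0 x
    rw [PowerSeries.coeff_zero_eq_constantCoeff_apply] at this ⊢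
    rw [map_pow, this, zero_pow two_ne_zero]
  rw [riccati_coeff hD, h2, if_pos rfl, zero_add] at h1
  refine mul_left_cancel₀ (mul_ne_zero two_ne_zero Complex.I_ne_zero) ?_
  linear_combination h1

/-- The two extreme terms of the convolution vanish with the constant term, which leaves the
summation range of the recurrence for `μ_n`. -/
lemma coeff_succ_sq {φ : PowerSeries ℂ} (h0 : PowerSeries.coeff 0 φ = 0) (n : ℕ) :
    PowerSeries.coeff (n + 1) (φ ^ 2) = ∑ k : Fin n,
      PowerSeries.coeff (k.1 + 1) φ * PowerSeries.coeff (n - k.1) φ := by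
  rw [sq, PowerSeries.coeff_mul, Finset.Nat.sum_antidiagonal_succ,
    Finset.Nat.sum_antidiagonal_eq_sum_range_succ_mk, Finset.sum_range_succ, Nat.sub_self, h0,
    zero_mul, mul_zero, add_zero, zero_add, Finset.sum_range]

lemma riccatiCoeff_eq (hξ : SeriesDeriv ξ D)
    (hD : ∀ x, X * D x = 2 * C Complex.I * ξ x - C Complex.I * C (star (u x)) * X
      + C Complex.I * C (u x) * X * ξ x ^ 2) {e : Fin 2 → ℂ} (he : IsUnitVec e)
    {q : Fin 2 → ℝ → ℂ} (hq : ∀ l x, q l x = u x * star (e l)) (n : ℕ) (l : Fin 2) (x : ℝ) :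
    riccatiCoeff q n l x = e l * ((-2 * Complex.I) ^ n * PowerSeries.coeff n (ξ x)) := by
  have h0 := riccati_coeff_zero hD
  induction n using Nat.strong_induction_on generalizing l x with
  | _ n ih =>
    match n with
    | 0 => simp [riccatiCoeff, h0]
    | 1 =>
      rw [riccati_coeff_one hξ hD, riccatiCoeff]
      beta_reduce
      rw [hq, star_mul', star_star]
      ring
    | n + 2 =>
      have hder : deriv (riccatiCoeff q (n + 1) l) x
          = e l * ((-2 * Complex.I) ^ (n + 1) * PowerSeries.coeff (n + 1) (D x)) := by
        rw [show riccatiCoeff q (n + 1) l = _ from funext fun y => ih (n + 1) (by omega) l y]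
        exact (((hξ (n + 1) x).const_mul _).const_mul _).deriv
      rw [riccatiCoeff]
      beta_reduce
      rw [hder, riccati_coeff hD, if_neg n.succ_ne_zero, coeff_succ_sq (h0 x)]
      -- The sum over `m` collapses because `e` is a unit vector, and the powers of `-2i` combine to
      -- the exponent `n + 1`.
      have hsum : ∀ k : Fin n, riccatiCoeff q (k.1 + 1) l x
          * ∑ m : Fin 2, q m x * riccatiCoeff q (n - k.1) m x
          = e l * u x * (-2 * Complex.I) ^ (n + 1)
            * (PowerSeries.coeff (k.1 + 1) (ξ x) * PowerSeries.coeff (n - k.1) (ξ x)) := by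
        intro k
        have hk : n + 1 = (k.1 + 1) + (n - k.1) := by omega
        rw [Fin.sum_univ_two, ih (k.1 + 1) (by omega), ih (n - k.1) (by omega),
          ih (n - k.1) (by omega), hq, hq, hk, pow_add]
        rw [IsUnitVec] at he
        linear_combination (e l * u x * (-2 * Complex.I) ^ (k.1 + 1)
          * (-2 * Complex.I) ^ (n - k.1) * (PowerSeries.coeff (k.1 + 1) (ξ x)
          * PowerSeries.coeff (n - k.1) (ξ x))) * he
      rw [Finset.sum_congr rfl fun k _ => hsum k, ← Finset.mul_sum]
      ring

lemma conservedDensity_eq (hξ : SeriesDeriv ξ D)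
    (hD : ∀ x, X * D x = 2 * C Complex.I * ξ x - C Complex.I * C (star (u x)) * X
      + C Complex.I * C (u x) * X * ξ x ^ 2) {e : Fin 2 → ℂ} (he : IsUnitVec e)
    {q : Fin 2 → ℝ → ℂ} (hq : ∀ l x, q l x = u x * star (e l)) (n : ℕ) (x : ℝ) :
    conservedDensity q n x
      = Complex.I * (-2 * Complex.I) ^ n * (u x * PowerSeries.coeff n (ξ x)) := by
  rw [conservedDensity, Fin.sum_univ_two, riccatiCoeff_eq hξ hD he hq, riccatiCoeff_eq hξ hD he hq,
    hq, hq]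
  rw [IsUnitVec] at he
  linear_combination (Complex.I * (-2 * Complex.I) ^ n * (u x * PowerSeries.coeff n (ξ x))) * he

end RiccatiCoeff

/-! ### The scattering coefficient -/

lemma derivative_geom (a : ℂ) : PowerSeries.derivative ℂ (geom a) = C a * geom a ^ 2 := by
  have e := one_sub_mul_geom a
  have h : (1 - C a * X) * PowerSeries.derivative ℂ (geom a) = C a * geom a := by
    have := congrArg (PowerSeries.derivative ℂ) e
    rw [Derivation.leibniz, map_sub, Derivation.leibniz] at this
    simp only [smul_eq_mul, PowerSeries.derivative_C, PowerSeries.derivative_X,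
      Derivation.map_one_eq_zero] at this
    linear_combination this
  linear_combination (-PowerSeries.derivative ℂ (geom a)) * e + geom a * h

/-- The series is `(1 - bX) / (1 - aX)`, and `X d/dX log (1 - aX) = 1 - geom a`. -/
lemma X_mul_derivative_blaschke (a b : ℂ) :
    X * PowerSeries.derivative ℂ (1 - C (b - a) * (X * geom a))
      = (1 - C (b - a) * (X * geom a)) * (geom a - geom b) := by
  rw [map_sub, Derivation.leibniz, Derivation.leibniz, derivative_geom]
  simp only [smul_eq_mul, PowerSeries.derivative_C, PowerSeries.derivative_X,
    Derivation.map_one_eq_zero, map_sub]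
  linear_combination ((C b - C a) * X * geom a - geom b) * one_sub_mul_geom a
    + geom a * one_sub_mul_geom b

lemma logDeriv_blaschke (a b : ℂ) (N : ℕ) :
    X * PowerSeries.derivative ℂ ((1 - C (b - a) * (X * geom a)) ^ N)
      * ((1 - C (b - a) * (X * geom a)) ^ N)⁻¹ = (N : PowerSeries ℂ) * (geom a - geom b) := by
  have h1 := X_mul_derivative_blaschke a b
  have hE : PowerSeries.constantCoeff (1 - C (b - a) * (X * geom a)) = 1 := by simp
  generalize 1 - C (b - a) * (X * geom a) = E at *
  have h2 : E ^ N * (E ^ N)⁻¹ = 1 := PowerSeries.mul_inv_cancel _ (by simp [hE])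
  have h3 : X * PowerSeries.derivative ℂ (E ^ N)
      = E ^ N * ((N : PowerSeries ℂ) * (geom a - geom b)) := by
    rw [Derivation.leibniz_pow]
    cases N with
    | zero => simp
    | succ N =>
      rw [Nat.add_sub_cancel, nsmul_eq_mul, smul_eq_mul, pow_succ]
      linear_combination (((N + 1 : ℕ) : PowerSeries ℂ) * E ^ N) * h1
  rw [h3]
  linear_combination ((N : PowerSeries ℂ) * (geom a - geom b)) * h2

/-! ### The vacuum data -/

section Vacuum

variable {lam κ : ℂ} {t : ℝ}

lemma isWave_vacuumCoeff (lam κ : ℂ) (t : ℝ) :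
    IsWave (-Complex.I) lam (fun _ => 0) (vacuumCoeff lam κ t) where
  fst k x := (hasDerivAt_expCoeff _ _ _ _ _).congr_deriv (by simp [vacuumCoeff])
  snd k x := by
    refine ((hasDerivAt_expCoeff Complex.I lam t k x).const_mul κ).congr_deriv ?_
    cases k <;> simp [vacuumCoeff, prev] <;> ring

lemma smoothPair_vacuumCoeff (lam κ : ℂ) (t : ℝ) : SmoothPair (vacuumCoeff lam κ t) :=
  fun k => ⟨contDiff_expCoeff _ _ _ k, contDiff_const.mul (contDiff_expCoeff _ _ _ k)⟩

lemma isBigO_expCoeff_zero {η : ℝ} {a : ℝ → ℂ} {c s : ℂ} (hc : c ≠ 0) (hs : s.re = η)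
    (h : ∀ x, a x = c * Complex.exp (s * x)) :
    (fun x : ℝ => Real.exp (η * x)) =O[atTop] a := by
  have h1 : (fun x : ℝ => Real.exp (η * x)) =O[atTop] fun x : ℝ => Complex.exp (s * x) := by
    apply Asymptotics.isBigO_of_le
    intro x
    simp [Complex.norm_exp, hs]
  refine h1.trans ?_
  simp only [funext h]
  exact Asymptotics.isBigO_self_const_mul hc _ _

lemma fstDominant_vacuumCoeff (lam κ : ℂ) (t : ℝ) :
    FstDominant lam.im (vacuumCoeff lam κ t) where
  fst_type k := (expType_expCoeff (-Complex.I) lam t k).mono (by simp)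
  snd_type k := ((expType_expCoeff Complex.I lam t k).mono (by simp)).const_mul κ
  lower := isBigO_expCoeff_zero (Complex.exp_ne_zero (-Complex.I * lam ^ 2 * t))
    (s := -Complex.I * lam) (by simp) fun x => by
      simp only [vacuumCoeff, expCoeff_zero]; ring

/-- After `x ↦ -x` the other exponential grows; its amplitude is `κ`, so `κ ≠ 0` is essential. -/
lemma fstDominant_vacuumCoeff_neg (hκ : κ ≠ 0) (lam : ℂ) (t : ℝ) :
    FstDominant lam.im (fun x => (vacuumCoeff lam κ t (-x)).swap) where
  fst_type k := ((expType_expCoeff_neg Complex.I lam t k).mono (by simp)).const_mul κ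
  snd_type k := (expType_expCoeff_neg (-Complex.I) lam t k).mono (by simp)
  lower := isBigO_expCoeff_zero (mul_ne_zero hκ (Complex.exp_ne_zero (Complex.I * lam ^ 2 * t)))
    (s := -(Complex.I * lam)) (by simp) fun x => by
      simp only [vacuumCoeff, expCoeff_zero, Prod.fst_swap]
      push_cast
      ring_nf

/-- The projections of all Darboux steps tend to a diagonal matrix along `l`, at rate `E`. -/
def ProjAsymptotics (ν ε : ℂ) (w : ℝ → CoeffPair) (l : Filter ℝ) (E : ℝ → ℝ) : Prop :=
  ∀ j, (fun x => projOff ((dress ν)^[j] (w x))) =O[l] E ∧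
    (fun x => projDiag ((dress ν)^[j] (w x)) - ε) =O[l] E

lemma projAsymptotics_atTop (hlam : 0 < lam.im) (κ : ℂ) (t : ℝ) (ν : ℂ) :
    ProjAsymptotics ν 1 (vacuumCoeff lam κ t) atTop (fun x => Real.exp (-lam.im * x)) := by
  intro j
  have hw := fun x => gram_vacuumCoeff_ne_zero lam κ t x
  have h := (fstDominant_vacuumCoeff lam κ t).iterate_dress hlam ν hw j
  refine ⟨h.isBigO_projOff hlam, ?_⟩
  refine ((h.isBigO_projDiag_swap hlam).neg_left).congr_left fun x => ?_
  rw [projDiag_swap (gram_iterate_ne_zero ν (hw x) j)]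
  ring

lemma isBigO_atBot_of_neg {η : ℝ} {f : ℝ → ℂ}
    (h : (fun x => f (-x)) =O[atTop] fun x : ℝ => Real.exp (-η * x)) :
    f =O[atBot] fun x : ℝ => Real.exp (η * x) := by
  have := h.comp_tendsto tendsto_neg_atBot_atTop
  simpa [Function.comp_def] using this

lemma projAsymptotics_atBot (hlam : 0 < lam.im) (hκ : κ ≠ 0) (t : ℝ) (ν : ℂ) :
    ProjAsymptotics ν 0 (vacuumCoeff lam κ t) atBot (fun x => Real.exp (lam.im * x)) := by
  intro j
  have h := (fstDominant_vacuumCoeff_neg hκ lam t).iterate_dress hlam ν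
    (fun x => by rw [gram_swap]; exact gram_vacuumCoeff_ne_zero lam κ t (-x)) j
  constructor
  · apply isBigO_atBot_of_neg
    have := (h.isBigO_projOff hlam).norm_left
    simp only [iterate_dress_swap, projOff_swap, norm_star] at this
    exact this.of_norm_left
  · apply isBigO_atBot_of_neg
    have := h.isBigO_projDiag_swap hlam
    simp only [iterate_dress_swap, Prod.swap_swap] at this
    simpa only [sub_zero] using this

end Vacuum

/-! ### Decay of the potential -/

section Decay

variable {lam ε : ℂ} {w : ℝ → CoeffPair} {l : Filter ℝ} {E : ℝ → ℝ}

lemma isBigO_scalarPot {ν : ℂ} (h : ProjAsymptotics ν ε w l E) (N : ℕ) :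
    (fun x => scalarPot ν (w x) N) =O[l] E :=
  (Asymptotics.IsBigO.fun_sum fun i _ => (h i).1).const_mul_left _

/-- The derivative is an explicit polynomial in the projections and earlier potentials, each term
containing a decaying factor. -/
lemma isBigO_deriv_scalarPot (hW : IsWave (-Complex.I) lam (fun _ => 0) w)
    (hw : ∀ x, gram (w x) ≠ 0) (h : ProjAsymptotics (lam - star lam) ε w l E)
    (hE : Tendsto E l (𝓝 0)) (N : ℕ) :
    (deriv fun x => scalarPot (lam - star lam) (w x) N) =O[l] E := by
  have hs : star (-Complex.I) = - -Complex.I := by simp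
  have hd : ∀ x, HasDerivAt (fun x => scalarPot (lam - star lam) (w x) N) _ x := fun x =>
    (HasDerivAt.fun_sum fun j _ => (hW.iterate_dress hs hw j).hasDerivAt_projOff hs
      (fun x => gram_iterate_ne_zero _ (hw x) j) x).const_mul _
  rw [show (deriv fun x => scalarPot (lam - star lam) (w x) N) = _ from
    funext fun x => (hd x).deriv]
  refine (Asymptotics.IsBigO.fun_sum fun j _ => ?_).const_mul_left _
  have hp : (fun x => projDiag ((dress (lam - star lam))^[j] (w x))) =O[l] fun _ => (1 : ℝ) := by
    have h1 := ((h j).2.trans (hE.isBigO_one ℝ)).add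
      (Asymptotics.isBigO_const_const ε (one_ne_zero (α := ℝ)) l)
    simpa using h1
  have hone : (fun _ : ℝ => (1 : ℂ)) =O[l] fun _ => (1 : ℝ) :=
    Asymptotics.isBigO_const_const _ one_ne_zero l
  have hr := (h j).1
  have hu := isBigO_scalarPot h j
  refine Asymptotics.IsBigO.const_mul_left (((hr.const_mul_left _).add ?_).sub ?_) _
  · simpa using hu.mul (hone.sub (hp.const_mul_left 2))
  · simpa using (hr.const_mul_left (lam - star lam)).mul ((hp.const_mul_left 2).sub hone)

end Decay

lemma integrable_of_isBigO_exp {η : ℝ} (hη : 0 < η) {E : Type*} [NormedAddCommGroup E] {f : ℝ → E}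
    (hf : Continuous f)
    (hb : f =O[atBot] fun x : ℝ => Real.exp (η * x))
    (ht : f =O[atTop] fun x : ℝ => Real.exp (-η * x)) : Integrable f := by
  refine hf.locallyIntegrable.integrable_of_isBigO_atBot_atTop hb ?_ ht ?_
  · exact ⟨Set.Iic 0, Iic_mem_atBot 0, integrableOn_exp_mul_Iic hη 0⟩
  · exact ⟨Set.Ioi 0, Ioi_mem_atTop 0, exp_neg_integrableOn_Ioi 0 hη⟩

/-! ### Conserved quantities of the scalar potential -/

lemma tendsto_exp_atBot {η : ℝ} (hη : 0 < η) :
    Tendsto (fun x : ℝ => Real.exp (η * x)) atBot (𝓝 0) :=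
  Real.tendsto_exp_atBot.comp (tendsto_id.const_mul_atBot hη)

lemma tendsto_exp_neg_atTop {η : ℝ} (hη : 0 < η) :
    Tendsto (fun x : ℝ => Real.exp (-η * x)) atTop (𝓝 0) :=
  Real.tendsto_exp_atBot.comp (tendsto_id.const_mul_atTop_of_neg (neg_neg_of_pos hη))

lemma ProjAsymptotics.dressSeries_tendsto {lam ε : ℂ} {w : ℝ → CoeffPair} {l : Filter ℝ}
    {E : ℝ → ℝ} (h : ProjAsymptotics (lam - star lam) ε w l E) (hE : Tendsto E l (𝓝 0)) (N : ℕ) :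
    SeriesTendsto (fun x => (dressSeries lam (w x) N).1) l
        ((1 - C ((lam - star lam) * ε) * (X * geom (star lam))) ^ N) ∧
      SeriesTendsto (fun x => (dressSeries lam (w x) N).2) l 0 :=
  CNLS.dressSeries_tendsto
    (fun j => tendsto_sub_nhds_zero_iff.1 ((h j).2.trans_tendsto hE))
    (fun j => (h j).1.trans_tendsto hE) N

/-- The limits of the ratio and of the logarithmic derivative of the formal solution. -/
lemma ProjAsymptotics.limits {lam ε b : ℂ} {w : ℝ → CoeffPair} {l : Filter ℝ}
    {E : ℝ → ℝ} (h : ProjAsymptotics (lam - star lam) ε w l E) (hE : Tendsto E l (𝓝 0))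
    (hb : (lam - star lam) * ε = b - star lam) (N : ℕ) :
    SeriesTendsto (fun x => (dressSeries lam (w x) N).2 * (dressSeries lam (w x) N).1⁻¹) l 0 ∧
    SeriesTendsto (fun x => X * PowerSeries.derivative ℂ (dressSeries lam (w x) N).1
      * (dressSeries lam (w x) N).1⁻¹) l ((N : PowerSeries ℂ) * (geom (star lam) - geom b)) := by
  obtain ⟨hF, hG⟩ := h.dressSeries_tendsto hE N
  rw [hb] at hF
  have hinv := hF.inv (fun x => constantCoeff_dressSeries lam (w x) N) (by simp)
  exact ⟨(hG.mul hinv).congr_lim (zero_mul _),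
    (hF.X_mul_derivative.mul hinv).congr_lim (logDeriv_blaschke _ _ _)⟩

/-- The decaying solution of the Riccati equation for the potential `u`, as a formal power series
in `1 / λ`, with the integrals of the densities it generates. -/
structure RiccatiSolution (N : ℕ) (lam : ℂ) (u : ℝ → ℂ) (ξ D : ℝ → PowerSeries ℂ) : Prop where
  hasDeriv : SeriesDeriv ξ D
  eqn : ∀ x, X * D x = 2 * C Complex.I * ξ x - C Complex.I * C (star (u x)) * X
    + C Complex.I * C (u x) * X * ξ x ^ 2
  tendsto_atTop : SeriesTendsto ξ atTop 0
  tendsto_atBot : SeriesTendsto ξ atBot 0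
  integrable : ∀ n, Integrable (fun x => u x * PowerSeries.coeff n (ξ x))
  integral : ∀ n, n ≠ 0 → ∫ x, u x * PowerSeries.coeff n (ξ x)
    = Complex.I * N * (star lam ^ n - lam ^ n) / n

lemma FormalSolution.exists_riccatiSolution {u : ℝ → ℂ} {F G : ℝ → PowerSeries ℂ} {η : ℝ}
    (h : FormalSolution u F G) (h1 : ∀ x, PowerSeries.constantCoeff (F x) = 1)
    (hu : Continuous u) (hη : 0 < η)
    (huT : u =O[atTop] fun x : ℝ => Real.exp (-η * x))
    (huB : u =O[atBot] fun x : ℝ => Real.exp (η * x))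
    (hξT : SeriesTendsto (fun x => G x * (F x)⁻¹) atTop 0)
    (hξB : SeriesTendsto (fun x => G x * (F x)⁻¹) atBot 0) {N : ℕ} {lam : ℂ}
    (hLT : SeriesTendsto (fun x => X * PowerSeries.derivative ℂ (F x) * (F x)⁻¹) atTop
      ((N : PowerSeries ℂ) * (geom (star lam) - geom lam)))
    (hLB : SeriesTendsto (fun x => X * PowerSeries.derivative ℂ (F x) * (F x)⁻¹) atBot 0) :
    ∃ D, RiccatiSolution N lam u (fun x => G x * (F x)⁻¹) D := by
  obtain ⟨D, hD, hR⟩ := h.riccati h1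
  have hL := h.logDeriv h1
  have hint : ∀ n, Integrable (fun x => u x * PowerSeries.coeff n (G x * (F x)⁻¹)) := fun n => by
    have hc : Continuous (fun x => PowerSeries.coeff n (G x * (F x)⁻¹)) :=
      continuous_iff_continuousAt.2 fun x => (hD n x).continuousAt
    -- The coefficients of `ξ` converge at both ends, hence are bounded there; the decay comes from
    -- `u`.
    refine integrable_of_isBigO_exp hη (hu.mul hc) ?_ ?_
    · simpa using huB.mul ((hξB n).isBigO_one ℝ)
    · simpa using huT.mul ((hξT n).isBigO_one ℝ)
  refine ⟨D, hD, hR, hξT, hξB, hint, fun n hn => ?_⟩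
  obtain ⟨m, rfl⟩ := Nat.exists_eq_succ_of_ne_zero hn
  have hder : ∀ x, HasDerivAt
      (fun y => PowerSeries.coeff (m + 1) (X * PowerSeries.derivative ℂ (F y) * (F y)⁻¹))
      (-(Complex.I * (m + 1)) * (u x * PowerSeries.coeff (m + 1) (G x * (F x)⁻¹))) x := fun x => by
    refine (hL (m + 1) x).congr_deriv ?_
    rw [PowerSeries.coeff_succ_X_mul, PowerSeries.coeff_derivative, ← map_neg, ← map_mul,
      PowerSeries.coeff_C_mul]
    ring
  -- The coefficient of `X^n` in `X F_X / F` is a primitive of `-i n u ξ_n`, so its boundary values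
  -- give the integral.
  have key := integral_of_hasDerivAt_of_tendsto hder ((hint (m + 1)).const_mul _)
    (hLB (m + 1)) (hLT (m + 1))
  rw [integral_const_mul, ← map_natCast (C (R := ℂ)) N, PowerSeries.coeff_C_mul, map_zero, sub_zero,
    map_sub, geom, geom, PowerSeries.coeff_mk, PowerSeries.coeff_mk] at key
  have hm : (m : ℂ) + 1 ≠ 0 := Nat.cast_add_one_ne_zero m
  rw [Nat.succ_eq_add_one, Nat.cast_add_one, eq_div_iff hm]
  linear_combination Complex.I * key + (m + 1) *
    (∫ x, u x * PowerSeries.coeff (m + 1) (G x * (F x)⁻¹)) * Complex.I_sq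

lemma exists_riccatiSolution {lam κ : ℂ} (hlam : 0 < lam.im) (hκ : κ ≠ 0) (t : ℝ) (N : ℕ) :
    ∃ ξ D, RiccatiSolution N lam
      (fun x => scalarPot (lam - star lam) (vacuumCoeff lam κ t x) N) ξ D := by
  have hw := fun x => gram_vacuumCoeff_ne_zero lam κ t x
  have hT := projAsymptotics_atTop hlam κ t (lam - star lam)
  have hB := projAsymptotics_atBot hlam hκ t (lam - star lam)
  -- At `+∞`, `b = lam` gives the full Blaschke factor; at `-∞`, `b = star lam` makes it trivial.
  obtain ⟨hξT, hLT⟩ := hT.limits (tendsto_exp_neg_atTop hlam) (b := lam) (mul_one _) N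
  obtain ⟨hξB, hLB⟩ := hB.limits (tendsto_exp_atBot hlam) (b := star lam) (by simp) N
  exact ⟨_, (dressSeries_formalSolution (isWave_vacuumCoeff lam κ t) hw N).exists_riccatiSolution
    (fun x => constantCoeff_dressSeries lam (vacuumCoeff lam κ t x) N)
    ((smoothPair_vacuumCoeff lam κ t).scalarPot _ hw N).continuous hlam (isBigO_scalarPot hT N)
    (isBigO_scalarPot hB N) hξT hξB hLT (hLB.congr_lim (by simp))⟩

/-! ### Mass, momentum, energy and the hierarchy for the scalar potential -/

namespace RiccatiSolution

variable {N : ℕ} {lam : ℂ} {u : ℝ → ℂ} {ξ D : ℝ → PowerSeries ℂ}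

lemma coeff_one (h : RiccatiSolution N lam u ξ D) (x : ℝ) :
    PowerSeries.coeff 1 (ξ x) = star (u x) / 2 :=
  riccati_coeff_one h.hasDeriv h.eqn x

lemma coeff_two (h : RiccatiSolution N lam u ξ D) {u' : ℝ → ℂ} (hu : ∀ x, HasDerivAt u (u' x) x)
    (x : ℝ) : 4 * Complex.I * PowerSeries.coeff 2 (ξ x) = star (u' x) := by
  have h1 := (h.hasDeriv 1 x).unique (((hu x).star.div_const 2).congr_of_eventuallyEq
    (Eventually.of_forall h.coeff_one))
  rw [riccati_coeff h.eqn, coeff_succ_sq (riccati_coeff_zero h.eqn x)] at h1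
  simp only [one_ne_zero, if_false, Finset.univ_eq_empty, Finset.sum_empty] at h1
  linear_combination 2 * h1

lemma hasDerivAt_coeff_two (h : RiccatiSolution N lam u ξ D) (x : ℝ) :
    HasDerivAt (fun y => PowerSeries.coeff 2 (ξ y))
      (2 * Complex.I * PowerSeries.coeff 3 (ξ x) + Complex.I * u x * star (u x) ^ 2 / 4) x := by
  refine (h.hasDeriv 2 x).congr_deriv ?_
  rw [riccati_coeff h.eqn, coeff_succ_sq (riccati_coeff_zero h.eqn x)]
  simp [h.coeff_one]
  ring

/-- The mass. -/
lemma mass (h : RiccatiSolution N lam u ξ D) :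
    Integrable (fun x => ‖u x‖ ^ 2) ∧ ∫ x, ‖u x‖ ^ 2 = 4 * N * lam.im := by
  have e : ∀ x, ((‖u x‖ ^ 2 : ℝ) : ℂ) = 2 * (u x * PowerSeries.coeff 1 (ξ x)) := fun x => by
    rw [h.coeff_one, Complex.ofReal_pow, ← Complex.mul_conj']
    simp only [RCLike.star_def]
    ring
  have hi : Integrable fun x => ((‖u x‖ ^ 2 : ℝ) : ℂ) := by
    rw [funext e]
    exact (h.integrable 1).const_mul 2
  refine ⟨hi.re, ?_⟩
  have : ((∫ x, ‖u x‖ ^ 2 : ℝ) : ℂ) = ((4 * N * lam.im : ℝ) : ℂ) := by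
    rw [← integral_complex_ofReal, funext e, integral_const_mul, h.integral 1 one_ne_zero]
    apply Complex.ext <;> simp <;> ring
  exact_mod_cast this

/-- The momentum. -/
lemma momentum (h : RiccatiSolution N lam u ξ D) {u' : ℝ → ℂ} (hu : ∀ x, HasDerivAt u (u' x) x) :
    Integrable (fun x => u x * star (u' x) - star (u x) * u' x) ∧
    -(Complex.I / 2) * ∫ x, (u x * star (u' x) - star (u x) * u' x)
      = ((8 * N * lam.re * lam.im : ℝ) : ℂ) := by
  have hi := (h.integrable 2).const_mul (4 * Complex.I)
  have hi' : Integrable fun x => star (4 * Complex.I * (u x * PowerSeries.coeff 2 (ξ x))) :=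
    Complex.conjCLE.toContinuousLinearMap.integrable_comp hi
  -- Since `4i ξ_2 = star u'`, the momentum density is `4i u ξ_2` minus its conjugate.
  have e : ∀ x, u x * star (u' x) - star (u x) * u' x
      = 4 * Complex.I * (u x * PowerSeries.coeff 2 (ξ x))
        - star (4 * Complex.I * (u x * PowerSeries.coeff 2 (ξ x))) := fun x => by
    rw [mul_left_comm, h.coeff_two hu, star_mul', star_star]
  rw [funext e]
  refine ⟨hi.sub hi', ?_⟩
  rw [integral_sub hi hi']
  simp only [RCLike.star_def]
  rw [integral_conj, integral_const_mul, h.integral 2 two_ne_zero]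
  simp only [map_div₀, map_mul, map_sub, map_pow, RCLike.star_def, Complex.conj_I,
    Complex.conj_conj, Complex.conj_natCast, Complex.conj_ofNat, Nat.cast_ofNat]
  apply Complex.ext <;> simp [pow_two] <;> ring

/-- The energy. -/
lemma energy (h : RiccatiSolution N lam u ξ D) {u' : ℝ → ℂ} (hu : ∀ x, HasDerivAt u (u' x) x)
    {η : ℝ} (hη : 0 < η) (hc : Continuous u')
    (hT : u =O[atTop] fun x : ℝ => Real.exp (-η * x))
    (hB : u =O[atBot] fun x : ℝ => Real.exp (η * x))
    (hT' : u' =O[atTop] fun x : ℝ => Real.exp (-η * x))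
    (hB' : u' =O[atBot] fun x : ℝ => Real.exp (η * x)) :
    Integrable (fun x => ‖u' x‖ ^ 2 - (‖u x‖ ^ 2) ^ 2) ∧
    ∫ x, (‖u' x‖ ^ 2 - (‖u x‖ ^ 2) ^ 2)
      = 16 / 3 * N * lam.im * (3 * lam.re ^ 2 - lam.im ^ 2) := by
  have hcu : Continuous u := continuous_iff_continuousAt.2 fun x => (hu x).continuousAt
  have hsq : ∀ {l : Filter ℝ} {E : ℝ → ℝ}, Tendsto E l (𝓝 0) → u =O[l] E → u' =O[l] E →
      (fun x => ‖u' x‖ ^ 2 - (‖u x‖ ^ 2) ^ 2) =O[l] E := by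
    intro l E hE h0 h1
    have g0 := h0.norm_left
    have g1 := h1.norm_left
    have b0 := g0.trans (hE.isBigO_one ℝ)
    have b1 := g1.trans (hE.isBigO_one ℝ)
    refine Asymptotics.IsBigO.sub ?_ ?_
    · simpa [sq] using g1.mul b1
    · simpa [sq, mul_assoc] using g0.mul (b0.mul (b0.mul b0))
  have hi : Integrable (fun x => ‖u' x‖ ^ 2 - (‖u x‖ ^ 2) ^ 2) :=
    integrable_of_isBigO_exp hη (by fun_prop) (hsq (tendsto_exp_atBot hη) hB hB')
      (hsq (tendsto_exp_neg_atTop hη) hT hT')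
  refine ⟨hi, ?_⟩
  -- The energy density and `8 u ξ_3` differ by the derivative of `4i u ξ_2 = u * star u'`, whose
  -- boundary values vanish.
  have hF : ∀ x, HasDerivAt (fun y => 4 * Complex.I * (u y * PowerSeries.coeff 2 (ξ y)))
      (((‖u' x‖ ^ 2 - (‖u x‖ ^ 2) ^ 2 : ℝ) : ℂ) - 8 * (u x * PowerSeries.coeff 3 (ξ x))) x := by
    intro x
    refine (((hu x).fun_mul (h.hasDerivAt_coeff_two x)).const_mul (4 * Complex.I)).congr_deriv ?_
    push_cast
    rw [← Complex.mul_conj', ← Complex.mul_conj']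
    have e := h.coeff_two hu x
    simp only [RCLike.star_def] at e ⊢
    linear_combination u' x * e + (8 * u x * PowerSeries.coeff 3 (ξ x)
      + (u x) ^ 2 * (starRingEnd ℂ) (u x) ^ 2) * Complex.I_sq
  have hiC : Integrable (fun x => ((‖u' x‖ ^ 2 - (‖u x‖ ^ 2) ^ 2 : ℝ) : ℂ)) := hi.ofReal
  have hi3 := (h.integrable 3).const_mul 8
  have lim : ∀ {l : Filter ℝ} {E : ℝ → ℝ}, Tendsto E l (𝓝 0) → u =O[l] E → SeriesTendsto ξ l 0 →
      Tendsto (fun y => 4 * Complex.I * (u y * PowerSeries.coeff 2 (ξ y))) l (𝓝 0) := by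
    intro l E hE h0 h1
    simpa using ((h0.trans_tendsto hE).mul (h1 2)).const_mul (4 * Complex.I)
  have key := integral_of_hasDerivAt_of_tendsto hF (hiC.sub hi3)
    (lim (tendsto_exp_atBot hη) hB h.tendsto_atBot)
    (lim (tendsto_exp_neg_atTop hη) hT h.tendsto_atTop)
  rw [integral_sub hiC hi3, integral_const_mul, h.integral 3 three_ne_zero, sub_zero,
    integral_complex_ofReal, sub_eq_zero] at key
  have : ((∫ x, (‖u' x‖ ^ 2 - (‖u x‖ ^ 2) ^ 2) : ℝ) : ℂ)
      = ((16 / 3 * N * lam.im * (3 * lam.re ^ 2 - lam.im ^ 2) : ℝ) : ℂ) := by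
    rw [key]
    apply Complex.ext
    · simp [pow_succ]
      ring
    · simp [pow_succ]
      right
      ring
  exact_mod_cast this

/-- The whole hierarchy. -/
lemma hierarchy (h : RiccatiSolution N lam u ξ D) {e : Fin 2 → ℂ} (he : IsUnitVec e)
    {q : Fin 2 → ℝ → ℂ} (hq : ∀ l x, q l x = u x * star (e l)) {n : ℕ} (hn : n ≠ 0) :
    Integrable (fun x => conservedDensity q n x) ∧
    ∫ x, conservedDensity q n x = N * (-2 * Complex.I) ^ n * (lam ^ n - star lam ^ n) / n := by
  simp only [conservedDensity_eq h.hasDeriv h.eqn he hq]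
  refine ⟨(h.integrable n).const_mul _, ?_⟩
  rw [integral_const_mul, h.integral n hn]
  linear_combination (N * (-2 * Complex.I) ^ n * (star lam ^ n - lam ^ n) / n) * Complex.I_sq

end RiccatiSolution

lemma exists_unitVec {c₁ c₂ : ℂ} (hc : c₁ ≠ 0 ∨ c₂ ≠ 0) :
    ∃ κ : ℂ, κ ≠ 0 ∧ ∃ e, IsUnitVec e ∧ dressingVec c₁ c₂ = embed e 1 κ := by
  have hpos : 0 < ‖c₁‖ ^ 2 + ‖c₂‖ ^ 2 := by
    rcases hc with h | h
    · have := norm_pos_iff.2 h; positivity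
    · have := norm_pos_iff.2 h; positivity
  have hκ : ((√(‖c₁‖ ^ 2 + ‖c₂‖ ^ 2) : ℝ) : ℂ) ≠ 0 := by
    exact_mod_cast (Real.sqrt_pos.2 hpos).ne'
  have hsq : ((√(‖c₁‖ ^ 2 + ‖c₂‖ ^ 2) : ℝ) : ℂ) ^ 2
      = c₁ * star c₁ + c₂ * star c₂ := by
    rw [← Complex.ofReal_pow, Real.sq_sqrt hpos.le]
    simp [Complex.mul_conj, Complex.normSq_eq_norm_sq]
  have hst : star ((√(‖c₁‖ ^ 2 + ‖c₂‖ ^ 2) : ℝ) : ℂ) = (√(‖c₁‖ ^ 2 + ‖c₂‖ ^ 2) : ℝ) :=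
    Complex.conj_ofReal _
  generalize ((√(‖c₁‖ ^ 2 + ‖c₂‖ ^ 2) : ℝ) : ℂ) = κ at *
  refine ⟨κ, hκ, ![c₁ / κ, c₂ / κ], ?_, ?_⟩
  · simp only [IsUnitVec, Matrix.cons_val_zero, Matrix.cons_val_one, star_div₀, hst]
    field_simp
    rw [hsq]
  · ext i
    fin_cases i
    · rfl
    · change c₁ = κ * (c₁ / κ)
      field_simp
    · change c₂ = κ * (c₂ / κ)
      field_simp

lemma IsUnitVec.norm_sq {e : Fin 2 → ℂ} (he : IsUnitVec e) (z : ℂ) :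
    ‖z * star (e 0)‖ ^ 2 + ‖z * star (e 1)‖ ^ 2 = ‖z‖ ^ 2 := by
  have h : ‖e 0‖ ^ 2 + ‖e 1‖ ^ 2 = 1 := by
    have := he
    simp only [IsUnitVec, RCLike.star_def, Complex.mul_conj'] at this
    exact_mod_cast this
  rw [norm_mul, norm_mul, norm_star, norm_star]
  linear_combination ‖z‖ ^ 2 * h

end CNLS

end

theorem proposition1p1 (N : ℕ) (lam c₁ c₂ : ℂ) (hlam : 0 < lam.im) (hc : c₁ ≠ 0 ∨ c₂ ≠ 0)
    (t : ℝ) (q₁ q₂ : ℝ → ℂ)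
    (hq₁ : q₁ = CNLS.soliton lam c₁ c₂ N t 0) (hq₂ : q₂ = CNLS.soliton lam c₁ c₂ N t 1) :
    -- the limits in the construction exist and are nonzero, and the soliton is smooth in `x`
    (∀ (j : ℕ) (x s : ℝ), ∃ v : Fin 3 → ℂ, v ≠ 0 ∧
      Tendsto (fun z => (CNLS.waveFun lam c₁ c₂ j z x s).mulVec (CNLS.dressingVec c₁ c₂))
        (𝓝[≠] lam) (𝓝 v)) ∧
    ContDiff ℝ ∞ q₁ ∧ ContDiff ℝ ∞ q₂ ∧
    -- the first conserved quantity
    Integrable (fun x : ℝ => ‖q₁ x‖ ^ 2 + ‖q₂ x‖ ^ 2) ∧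
    (∫ x : ℝ, (‖q₁ x‖ ^ 2 + ‖q₂ x‖ ^ 2)) = 4 * N * lam.im ∧
    -- the second conserved quantity
    Integrable (fun x : ℝ => q₁ x * star (deriv q₁ x) + q₂ x * star (deriv q₂ x)
      - star (q₁ x) * deriv q₁ x - star (q₂ x) * deriv q₂ x) ∧
    -(Complex.I / 2) * (∫ x : ℝ, (q₁ x * star (deriv q₁ x) + q₂ x * star (deriv q₂ x)
      - star (q₁ x) * deriv q₁ x - star (q₂ x) * deriv q₂ x))
      = ((8 * N * lam.re * lam.im : ℝ) : ℂ) ∧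
    -- the third conserved quantity
    Integrable (fun x : ℝ => ‖deriv q₁ x‖ ^ 2 + ‖deriv q₂ x‖ ^ 2
      - (‖q₁ x‖ ^ 2 + ‖q₂ x‖ ^ 2) ^ 2) ∧
    (∫ x : ℝ, (‖deriv q₁ x‖ ^ 2 + ‖deriv q₂ x‖ ^ 2 - (‖q₁ x‖ ^ 2 + ‖q₂ x‖ ^ 2) ^ 2))
      = 16 / 3 * N * lam.im * (3 * lam.re ^ 2 - lam.im ^ 2) ∧
    -- the whole hierarchy
    (∀ n : ℕ, 1 ≤ n →
      Integrable (fun x : ℝ => CNLS.conservedDensity ![q₁, q₂] n x) ∧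
      (∫ x : ℝ, CNLS.conservedDensity ![q₁, q₂] n x)
        = N * (-2 * Complex.I) ^ n * (lam ^ n - star lam ^ n) / n) := by
  obtain ⟨κ, hκ, e, he, hce⟩ := CNLS.exists_unitVec hc
  have hw := fun x => CNLS.gram_vacuumCoeff_ne_zero lam κ t x
  have hsm := (CNLS.smoothPair_vacuumCoeff lam κ t).scalarPot (lam - star lam) hw N
  have hW := CNLS.isWave_vacuumCoeff lam κ t
  have hT := CNLS.projAsymptotics_atTop hlam κ t (lam - star lam)
  have hB := CNLS.projAsymptotics_atBot hlam hκ t (lam - star lam)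
  have huT := CNLS.isBigO_scalarPot hT N
  have huB := CNLS.isBigO_scalarPot hB N
  have huT' := CNLS.isBigO_deriv_scalarPot hW hw hT (CNLS.tendsto_exp_neg_atTop hlam) N
  have huB' := CNLS.isBigO_deriv_scalarPot hW hw hB (CNLS.tendsto_exp_atBot hlam) N
  obtain ⟨ξ, D, hR⟩ := CNLS.exists_riccatiSolution hlam hκ t N
  replace hq₁ : q₁ = fun x => CNLS.scalarPot (lam - star lam) (CNLS.vacuumCoeff lam κ t x) N
      * star (e 0) := hq₁.trans (funext fun x => CNLS.solitonPotential_apply hlam he hce N t 0 x)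
  replace hq₂ : q₂ = fun x => CNLS.scalarPot (lam - star lam) (CNLS.vacuumCoeff lam κ t x) N
      * star (e 1) := hq₂.trans (funext fun x => CNLS.solitonPotential_apply hlam he hce N t 1 x)
  set u : ℝ → ℂ := fun x => CNLS.scalarPot (lam - star lam) (CNLS.vacuumCoeff lam κ t x) N with hu
  have hu' : ∀ x, HasDerivAt u (deriv u x) x := fun x =>
    (hsm.differentiable (by simp) x).hasDerivAt
  have hd₁ : ∀ x, deriv q₁ x = deriv u x * star (e 0) := fun x => by
    rw [hq₁]; exact ((hu' x).mul_const _).deriv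
  have hd₂ : ∀ x, deriv q₂ x = deriv u x * star (e 1) := fun x => by
    rw [hq₂]; exact ((hu' x).mul_const _).deriv
  have hv₁ : ∀ x, q₁ x = u x * star (e 0) := fun x => by rw [hq₁]
  have hv₂ : ∀ x, q₂ x = u x * star (e 1) := fun x => by rw [hq₂]
  -- The direction `e` is constant in `x`, so it factors out of the derivatives and contributes
  -- `|e|² = 1`.
  have hmom : ∀ x, q₁ x * star (deriv q₁ x) + q₂ x * star (deriv q₂ x)
      - star (q₁ x) * deriv q₁ x - star (q₂ x) * deriv q₂ x
      = u x * star (deriv u x) - star (u x) * deriv u x := fun x => by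
    have he' := he
    rw [CNLS.IsUnitVec] at he'
    rw [hd₁, hd₂, hv₁, hv₂]
    simp only [star_mul', star_star]
    linear_combination (u x * star (deriv u x) - star (u x) * deriv u x) * he'
  have hmass := hR.mass
  have hmomentum := hR.momentum hu'
  have henergy := hR.energy hu' hlam (hsm.continuous_deriv (by simp)) huT huB huT' huB'
  refine ⟨fun j x s => ?_, ?_, ?_, ?_⟩
  · refine ⟨_, CNLS.embed_ne_zero he ?_, (CNLS.hasExpansion hlam he hce j x s).tendsto hlam⟩
    exact CNLS.gram_iterate_ne_zero _ (CNLS.gram_vacuumCoeff_ne_zero lam κ s x) j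
  · rw [hq₁]; exact hsm.mul contDiff_const
  · rw [hq₂]; exact hsm.mul contDiff_const
  · simp only [hmom]
    simp only [hd₁, hd₂, hv₁, hv₂, he.norm_sq]
    refine ⟨hmass.1, hmass.2, hmomentum.1, hmomentum.2, henergy.1, henergy.2, fun n hn => ?_⟩
    exact hR.hierarchy he (fun l x => by fin_cases l <;> simp [hv₁, hv₂]) (by omega)
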